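/- A space $X$ is called nilpotent if it is path connected, $\pi_1(X,x)$ is a nilpotent group, and $\pi_1(X,x)$ acts nilpotently on $\pi_n(X,x)$ for every $n\ge 2$ and every base point $x$; the last condition means that for each $n \ge 2$ there is $c$ with $\Gamma_c=0$, where $\Gamma_0=\pi_n(X,x)$ and $\Gamma_{k+1}$ is the subgroup generated by all $g\cdot a-a$ with $g\in\pi_1(X,x)$, $a\in\Gamma_k$. **Proposition.** Let $L$ be a CW complex with a base point $x_0\in L$. Let $SP(L)=\operatorname{colim}_n L^n/S_n$ be its infinite symmetric product (the colimit being taken along the maps that insert $x_0$), with the colimit topology, and let $i\colon L\to SP(L)$ be the inclusion. Let $$F=\{(l,\omega)\in L\times SP(L)^{[0,1]} : \omega(0)=i(x_0),\ \omega(1)=i(l)\}$$ be the homotopy fiber of $i$. If $L$ is nilpotent, then $F$ is nilpotent. -/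

import Mathlib

open scoped unitInterval Topology Topology.Homotopy

universe u v

noncomputable section

/-! ### The action of the fundamental group on the homotopy groups -/

namespace PiOneAction

set_option linter.unusedSectionVars false

variable {N : Type*} [Fintype N] {X : Type u} [TopologicalSpace X]

/-- The sup-norm distance of a point of the cube `I^N` from the centre of the cube, scaled so that
it equals `1` exactly on the boundary (for nonempty `N`). -/
def radius (y : N → I) : ℝ := ‖fun i => 2 * (y i : ℝ) - 1‖

/-- The map of the cube to itself that stretches the concentric subcube `radius y ≤ 1 / 2` (that is,
`[1/4, 3/4]^N`) affinely onto the whole cube, and the rest onto the boundary. -/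
def stretch (y : N → I) : N → I :=
  fun i => Set.projIcc (0 : ℝ) 1 zero_le_one (2 * (y i : ℝ) - 1 / 2)

/-- The radial coordinate on the collar `1 / 2 ≤ radius y ≤ 1`, running from `0` on the inner
boundary to `1` on the boundary of the cube. -/
def collar (y : N → I) : I := Set.projIcc (0 : ℝ) 1 zero_le_one (2 * radius y - 1)

/-- The map which is a rescaled `f` on the concentric subcube `radius y ≤ 1 / 2`, and `γ` along the
radial segments of the remaining collar. -/
def glue (f : (N → I) → X) (γ : I → X) (y : N → I) : X :=
  open Classical in if radius y ≤ 1 / 2 then f (stretch y) else γ (collar y)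

theorem continuous_radius : Continuous (radius : (N → I) → ℝ) := by
  unfold radius; fun_prop

theorem continuous_stretch : Continuous (stretch : (N → I) → (N → I)) := by
  unfold stretch
  exact continuous_pi fun i => continuous_projIcc.comp (by fun_prop)

theorem continuous_collar : Continuous (collar : (N → I) → I) := by
  unfold collar
  exact continuous_projIcc.comp ((continuous_const.mul continuous_radius).sub continuous_const)

theorem exists_abs_eq_radius (y : N → I) (h : radius y ≠ 0) :
    ∃ i, |2 * (y i : ℝ) - 1| = radius y := by
  have hne : Nonempty N := by
    by_contra hN
    rw [not_nonempty_iff] at hN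
    exact h (by simp [radius, Subsingleton.elim (fun i => 2 * (y i : ℝ) - 1) 0])
  obtain ⟨i, -, hi⟩ := Finset.exists_mem_eq_sup' (s := Finset.univ) Finset.univ_nonempty
    (fun i => |2 * (y i : ℝ) - 1|)
  refine ⟨i, le_antisymm ?_ ?_⟩
  · exact norm_le_pi_norm (fun i => 2 * (y i : ℝ) - 1) i
  · refine (pi_norm_le_iff_of_nonneg (abs_nonneg _)).2 fun j => ?_
    rw [← hi, Real.norm_eq_abs]
    exact Finset.le_sup' (fun i => |2 * (y i : ℝ) - 1|) (Finset.mem_univ j)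

theorem stretch_mem_boundary {y : N → I} (h : radius y = 1 / 2) :
    stretch y ∈ Cube.boundary N := by
  obtain ⟨i, hi⟩ := exists_abs_eq_radius y (by rw [h]; norm_num)
  refine ⟨i, ?_⟩
  rw [h] at hi
  rcases eq_or_eq_neg_of_abs_eq hi with hi | hi
  · right; exact Set.projIcc_of_right_le _ (by linarith)
  · left; exact Set.projIcc_of_le_left _ (by linarith)

theorem collar_eq_zero {y : N → I} (h : radius y ≤ 1 / 2) : collar y = 0 :=
  Set.projIcc_of_le_left _ (by linarith)

theorem radius_of_mem_boundary {y : N → I} (h : y ∈ Cube.boundary N) : 1 ≤ radius y := by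
  obtain ⟨i, hi⟩ := h
  refine le_trans ?_ (norm_le_pi_norm (fun i => 2 * (y i : ℝ) - 1) i)
  rcases hi with hi | hi <;> norm_num [hi]

theorem glue_of_mem_boundary (f : (N → I) → X) (γ : I → X) {y : N → I}
    (h : y ∈ Cube.boundary N) : glue f γ y = γ 1 := by
  have hr := radius_of_mem_boundary h
  rw [glue, if_neg (by linarith)]
  exact congrArg γ (Set.projIcc_of_right_le _ (by linarith))

theorem continuous_glue {P : Type*} [TopologicalSpace P] {F : P × (N → I) → X} {G : P × I → X}
    (hF : Continuous F) (hG : Continuous G)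
    (h : ∀ p, ∀ y ∈ Cube.boundary N, F (p, y) = G (p, 0)) :
    Continuous fun q : P × (N → I) =>
      glue (fun y => F (q.1, y)) (fun t => G (q.1, t)) q.2 := by
  unfold glue
  refine Continuous.if_le (f := fun q : P × (N → I) => radius q.2) (g := fun _ => 1 / 2)
    (hF.comp (continuous_fst.prodMk (continuous_stretch.comp continuous_snd)))
    (hG.comp (continuous_fst.prodMk (continuous_collar.comp continuous_snd)))
    (continuous_radius.comp continuous_snd) continuous_const ?_
  rintro ⟨p, y⟩ hy
  change F (p, stretch y) = G (p, collar y)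
  rw [collar_eq_zero (le_of_eq hy), h p _ (stretch_mem_boundary hy)]

/-- Transport of a generalized loop along a path `γ` from `x` to `y`: a small copy of the loop in
the middle of the cube, surrounded by `γ` along the radial segments. -/
def genLoopTransport {x y : X} (γ : Path x y) (f : GenLoop N X x) : GenLoop N X y :=
  ⟨⟨glue f γ, by
    have := continuous_glue (P := Unit) (F := fun q => f q.2) (G := fun q => γ q.2)
      (by fun_prop) (by fun_prop) (fun _ z hz => by simp [GenLoop.boundary f z hz])
    exact this.comp (continuous_const.prodMk continuous_id : Continuous fun z => ((), z))⟩,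
  fun z hz => by
    change glue f γ z = y
    rw [glue_of_mem_boundary _ _ hz, γ.target]⟩

theorem genLoopTransport_homotopic {x y : X} {γ γ' : Path x y} {f f' : GenLoop N X x}
    (hγ : γ.Homotopic γ') (hf : GenLoop.Homotopic f f') :
    GenLoop.Homotopic (genLoopTransport γ f) (genLoopTransport γ' f') := by
  obtain ⟨G⟩ := hγ
  obtain ⟨F⟩ := hf
  refine ⟨⟨⟨⟨fun q => glue (fun z => F (q.1, z)) (fun t => G (q.1, t)) q.2, ?_⟩, ?_, ?_⟩, ?_⟩⟩
  · refine continuous_glue (F := fun q => F q) (G := fun q => G q) (by fun_prop) (by fun_prop) ?_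
    intro p z hz
    rw [F.eq_fst p hz]
    have h0 : G (p, 0) = x := by simp
    rw [h0]
    exact GenLoop.boundary f z hz
  · intro z
    simp only [ContinuousMap.HomotopyWith.apply_zero]
    rfl
  · intro z
    simp only [ContinuousMap.HomotopyWith.apply_one]
    rfl
  · intro t z hz
    have h1 : G (t, 1) = y := by simp
    change glue (fun z => F (t, z)) (fun s => G (t, s)) z = genLoopTransport γ f z
    rw [glue_of_mem_boundary _ _ hz, GenLoop.boundary (genLoopTransport γ f) z hz, h1]

/-- Transport `π_N(X, x) → π_N(X, y)` along a homotopy class of paths from `x` to `y`. -/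
def transport {x y : X} (γ : Path.Homotopic.Quotient x y) (a : HomotopyGroup N X x) :
    HomotopyGroup N X y :=
  Quotient.map₂ genLoopTransport (fun _ _ hγ _ _ hf => genLoopTransport_homotopic hγ hf) γ a

end PiOneAction

/-- The action of the fundamental group `π₁(X, x)` on the homotopy group `π_n(X, x)`. -/
def piOneAct {X : Type u} [TopologicalSpace X] {x : X} (n : ℕ)
    (g : FundamentalGroup X x) (a : π_ n X x) : π_ n X x :=
  PiOneAction.transport (FundamentalGroup.toPath g) a

/-! ### Nilpotent spaces -/

/-- The lower central series of the action of `π₁(X, x)` on the (multiplicatively written, abelian)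
group `π_{n+2}(X, x)`: `Γ₀` is the whole group, and `Γ_{k+1}` is the subgroup generated by the
elements `(g • a) a⁻¹` with `g ∈ π₁(X, x)` and `a ∈ Γ_k`. In terms of the augmentation ideal `J` of
`ℤ[π₁(X, x)]`, this is `J ^ k π_{n+2}(X, x)`. -/
def actionLowerCentralSeries (X : Type u) [TopologicalSpace X] (x : X) (n : ℕ) :
    ℕ → Subgroup (π_ (n + 2) X x)
  | 0 => ⊤
  | k + 1 => Subgroup.closure
      {b | ∃ g : FundamentalGroup X x, ∃ a ∈ actionLowerCentralSeries X x n k,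
        b = piOneAct (n + 2) g a * a⁻¹}

/-- A nilpotent space: it is (nonempty and) path connected, its fundamental group is nilpotent, and
the fundamental group acts nilpotently on each higher homotopy group. -/
structure IsNilpotentSpace (X : Type u) [TopologicalSpace X] : Prop where
  pathConnected : PathConnectedSpace X
  nilpotent_fundamentalGroup : ∀ x : X, Group.IsNilpotent (FundamentalGroup X x)
  nilpotent_action : ∀ (x : X) (n : ℕ), ∃ c : ℕ, actionLowerCentralSeries X x n c = ⊥

/-! ### The infinite symmetric product -/

/-- The multiset of the entries of a finite tuple that differ from the base point `x₀`. -/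
def reducedMultiset {X : Type u} (x₀ : X) (a : Σ n : ℕ, (Fin n → X)) : Multiset X :=
  open Classical in Multiset.filter (fun x => x ≠ x₀) (Finset.univ.val.map a.2)

/-- Two finite tuples are identified when they agree up to permuting entries and inserting or
deleting entries equal to the base point. -/
def symmetricProductSetoid {X : Type u} (x₀ : X) : Setoid (Σ n : ℕ, (Fin n → X)) :=
  Setoid.ker (reducedMultiset x₀)

/-- The infinite symmetric product `SP(X)` of the pointed space `(X, x₀)`: the colimit of the
finite symmetric products `SP^n(X) = X^n / S_n` along the maps that insert the base point. -/
def InfiniteSymmetricProduct {X : Type u} (x₀ : X) : Type u :=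
  Quotient (symmetricProductSetoid x₀)

/-- The colimit topology, i.e. the quotient topology from the disjoint union of the powers `X^n`. -/
instance {X : Type u} [TopologicalSpace X] (x₀ : X) :
    TopologicalSpace (InfiniteSymmetricProduct x₀) :=
  inferInstanceAs (TopologicalSpace (Quotient (symmetricProductSetoid x₀)))

/-- The inclusion `X = SP¹(X) → SP(X)`. -/
def InfiniteSymmetricProduct.incl {X : Type u} [TopologicalSpace X] (x₀ : X) :
    C(X, InfiniteSymmetricProduct x₀) where
  toFun x := Quotient.mk (symmetricProductSetoid x₀) ⟨1, fun _ => x⟩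
  continuous_toFun := continuous_quotient_mk'.comp
    ((@continuous_sigmaMk ℕ (fun n => Fin n → X) _ 1).comp
      (continuous_pi fun _ => continuous_id))

/-! ### The homotopy fiber -/

/-- The homotopy fiber of `f : X → Y` over `y`: pairs of a point `x` of `X` and a path in `Y`
from `y` to `f x`, topologized as a subspace of `X × Y^I` (compact-open topology on `Y^I`). -/
abbrev HomotopyFiber {X : Type u} {Y : Type v} [TopologicalSpace X] [TopologicalSpace Y]
    (f : C(X, Y)) (y : Y) : Type (max u v) :=
  {p : X × C(I, Y) // p.2 0 = y ∧ p.2 1 = f p.1}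

end

/-!
The homotopy fiber `F` of a map `f : X → Y` inherits nilpotency from `X` as soon as it is path
connected; for the inclusion `i : L → SP(L)`, path connectedness amounts to the surjectivity of
`π₁(L) → π₁(SP(L))`.

*Nilpotency.* The loop space `ΩY` acts on `F`, up to homotopy, by prepending loops to paths
(`HomotopyFiber.act`), and an element of the kernel of `π_n(F) → π_n(X)` is represented by a map
`y ↦ b y · z` with `b` a map from the cube to `ΩY` and `z` the base point
(`HomotopyFiber.exists_homotopicRel_act_base`). If `g` is a loop in `F`, then `(y, t) ↦ b y · g t`
is a free homotopy from this map to itself along `g`, so `g` acts trivially on its class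
(`HomotopyFiber.transport_eq_of_map_proj`). Hence, if the `c`-th term of the lower central series of
the action vanishes for `X`, the next one vanishes for `F`
(`actionLowerCentralSeries_eq_bot_of_map`). For `n = 1` the same map shows that the kernel of
`π₁(F) → π₁(X)` is central.

The base point with constant path is fixed by the constant loop of `Y`, which makes all of these
homotopies relative to it. Other base points are reduced to this one by transport along paths, whose
functoriality follows from the fact that a free homotopy along a path `γ` ends at the transport
along `γ` (`PiOneAction.FreelyHomotopic.genLoopTransport_homotopic`).

*Surjectivity on `π₁`.* A compact subset of `SP(L)` lies in a finite stage `L^n / S_n`, and paths in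
the orbit space of a finite group acting on a Hausdorff space lift
(`OrbitPath.OrbitContinuous.exists_isLift`). So a loop in `SP(L)` is represented by an `n`-tuple of
loops in `L` (`InfiniteSymmetricProduct.exists_lift_path`). Running through them one after the other
gives a homotopic loop, which is the image of their product in `L`
(`InfiniteSymmetricProduct.exists_homotopic_map_incl`).
-/

noncomputable section

/-! ### Lifting paths from the orbit space of a finite group -/

namespace OrbitPath

variable {G : Type*} [Group G] {X : Type*} [TopologicalSpace X] [MulAction G X]

/-- `a : ℝ → X`, itself possibly discontinuous, induces a continuous map from `ℝ` to the orbit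
space `H \ X`. -/
def OrbitContinuous (H : Subgroup G) (a : ℝ → X) : Prop :=
  ∀ t, ∀ V ∈ 𝓝 (a t), ∀ᶠ s in 𝓝 t, ∃ h ∈ H, h • a s ∈ V

/-- `k` takes values in `H` and moves `a` to a function that is continuous on `S`: a continuous
lift over `S` of the path in `H \ X` given by `a`. -/
def IsLift (H : Subgroup G) (a : ℝ → X) (S : Set ℝ) (k : ℝ → G) : Prop :=
  (∀ t, k t ∈ H) ∧ ContinuousOn (fun t => k t • a t) S

variable {H : Subgroup G} {a : ℝ → X}

theorem OrbitContinuous.comp (ha : OrbitContinuous H a) {φ : ℝ → ℝ} (hφ : Continuous φ) :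
    OrbitContinuous H (a ∘ φ) :=
  fun t V hV => hφ.continuousAt.eventually (ha (φ t) V hV)

theorem OrbitContinuous.smul [ContinuousConstSMul G X] (ha : OrbitContinuous H a) {k : ℝ → G}
    (hk : ∀ t, k t ∈ H) : OrbitContinuous H (fun t => k t • a t) := by
  intro t V hV
  filter_upwards [ha t _ ((continuous_const_smul (k t)).continuousAt.preimage_mem_nhds hV)]
    with s ⟨h, hh, hs⟩
  refine ⟨k t * h * (k s)⁻¹, H.mul_mem (H.mul_mem (hk t) hh) (H.inv_mem (hk s)), ?_⟩
  simpa [mul_smul] using hs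

theorem IsLift.mono {S T : Set ℝ} {k : ℝ → G} (hk : IsLift H a T k) (h : S ⊆ T) :
    IsLift H a S k :=
  ⟨hk.1, hk.2.mono h⟩

/-- Lifts over adjacent intervals can be glued, after translating the second one so that the two
agree at the common end point. -/
theorem IsLift.glue_right [ContinuousConstSMul G X] {c p d : ℝ} (hcp : c ≤ p) (hpd : p ≤ d)
    {k₁ k₂ : ℝ → G} (h₁ : IsLift H a (Set.Icc c p) k₁) (h₂ : IsLift H a (Set.Icc p d) k₂) :
    ∃ k, IsLift H a (Set.Icc c d) k ∧ Set.EqOn k k₁ (Set.Icc c p) := by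
  refine ⟨fun t => if t ≤ p then k₁ t else k₁ p * (k₂ p)⁻¹ * k₂ t, ⟨fun t => ?_, ?_⟩,
    fun t ht => if_pos ht.2⟩
  · dsimp only
    split_ifs
    · exact h₁.1 t
    · exact H.mul_mem (H.mul_mem (h₁.1 p) (H.inv_mem (h₂.1 p))) (h₂.1 t)
  · rw [← Set.Icc_union_Icc_eq_Icc hcp hpd]
    refine ContinuousOn.union_of_isClosed ?_ ?_ isClosed_Icc isClosed_Icc
    · exact h₁.2.congr fun t ht => by simp [ht.2]
    · refine (h₂.2.const_smul (k₁ p * (k₂ p)⁻¹)).congr fun t ht => ?_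
      rcases ht.1.eq_or_lt with rfl | h
      · simp [mul_smul]
      · simp [not_le.2 h, mul_smul]

theorem IsLift.glue_left [ContinuousConstSMul G X] {c p d : ℝ} (hcp : c ≤ p) (hpd : p ≤ d)
    {k₁ k₂ : ℝ → G} (h₁ : IsLift H a (Set.Icc c p) k₁) (h₂ : IsLift H a (Set.Icc p d) k₂) :
    ∃ k, IsLift H a (Set.Icc c d) k ∧ Set.EqOn k k₂ (Set.Icc p d) := by
  refine ⟨fun t => if p ≤ t then k₂ t else k₂ p * (k₁ p)⁻¹ * k₁ t, ⟨fun t => ?_, ?_⟩,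
    fun t ht => if_pos ht.1⟩
  · dsimp only
    split_ifs
    · exact h₂.1 t
    · exact H.mul_mem (H.mul_mem (h₂.1 p) (H.inv_mem (h₁.1 p))) (h₁.1 t)
  · rw [← Set.Icc_union_Icc_eq_Icc hcp hpd]
    refine ContinuousOn.union_of_isClosed ?_ ?_ isClosed_Icc isClosed_Icc
    · refine (h₁.2.const_smul (k₂ p * (k₁ p)⁻¹)).congr fun t ht => ?_
      rcases ht.2.eq_or_lt with rfl | h
      · simp [mul_smul]
      · simp [not_le.2 h, mul_smul]
    · exact h₂.2.congr fun t ht => by simp [ht.1]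

/-- If lifts exist near every point of an interval `K`, they exist over all compact subintervals. -/
theorem exists_isLift_uIcc [ContinuousConstSMul G X] {K : Set ℝ} (hK : IsPreconnected K)
    (hloc : ∀ t ∈ K, ∃ ε > 0, ∃ k, IsLift H a (Set.Icc (t - ε) (t + ε)) k) {x y : ℝ} (hx : x ∈ K)
    (hy : y ∈ K) : ∃ k, IsLift H a (Set.uIcc x y) k := by
  refine hK.induction₂ (fun x y => ∃ k, IsLift H a (Set.uIcc x y) k) ?_ ?_ ?_ hx hy
  · intro t ht
    obtain ⟨ε, hε, k, hk⟩ := hloc t ht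
    filter_upwards [mem_nhdsWithin_of_mem_nhds (Icc_mem_nhds (sub_lt_self t hε)
      (lt_add_of_pos_right t hε))] with s hs
    exact ⟨k, hk.mono (Set.uIcc_subset_Icc ⟨by linarith, by linarith⟩ hs)⟩
  · rintro x y z - - - ⟨k₁, h₁⟩ ⟨k₂, h₂⟩
    by_cases hz : z ∈ Set.uIcc x y
    · exact ⟨k₁, h₁.mono (Set.uIcc_subset_uIcc_left hz)⟩
    by_cases hx : x ∈ Set.uIcc y z
    · exact ⟨k₂, h₂.mono (Set.uIcc_subset_uIcc_right hx)⟩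
    rw [Set.mem_uIcc] at hz hx
    push Not at hz hx
    rcases le_total x y with hxy | hyx
    · have hyz : y ≤ z := by
        by_contra h
        grind
      rw [Set.uIcc_of_le hxy] at h₁
      rw [Set.uIcc_of_le hyz] at h₂
      rw [Set.uIcc_of_le (hxy.trans hyz)]
      exact (h₁.glue_right hxy hyz h₂).imp fun _ h => h.1
    · have hzy : z ≤ y := by
        by_contra h
        grind
      rw [Set.uIcc_of_ge hyx] at h₁
      rw [Set.uIcc_of_ge hzy] at h₂
      rw [Set.uIcc_of_ge (hzy.trans hyx)]
      exact (h₂.glue_right hzy hyx h₁).imp fun _ h => h.1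
  · rintro x y - - ⟨k, hk⟩
    exact ⟨k, by rwa [Set.uIcc_comm]⟩

/-- If lifts exist near every point of an open interval `K`, there is a lift over `K`. It is built
over an increasing sequence of compact subintervals that exhausts `K`. -/
theorem exists_isLift_of_local [ContinuousConstSMul G X] {K : Set ℝ} (hK : IsPreconnected K)
    (hKo : IsOpen K)
    (hloc : ∀ t ∈ K, ∃ ε > 0, ∃ k, IsLift H a (Set.Icc (t - ε) (t + ε)) k) :
    ∃ k, IsLift H a K k := by
  classical
  rcases K.eq_empty_or_nonempty with rfl | hne
  · exact ⟨fun _ => 1, fun _ => H.one_mem, continuousOn_empty _⟩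
  have : Nonempty K := hne.to_subtype
  -- the hulls `[c n, d n]` of the first terms of a dense sequence in `K` exhaust `K`
  let q : ℕ → ℝ := fun n => (TopologicalSpace.denseSeq K n : ℝ)
  have hq : ∀ n, q n ∈ K := fun n => (TopologicalSpace.denseSeq K n).2
  have hdense : ∀ U : Set ℝ, IsOpen U → (U ∩ K).Nonempty → ∃ n, q n ∈ U := by
    rintro U hU ⟨x, hxU, hxK⟩
    obtain ⟨n, hn⟩ := (TopologicalSpace.denseRange_denseSeq K).exists_mem_open
      (hU.preimage continuous_subtype_val) ⟨⟨x, hxK⟩, hxU⟩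
    exact ⟨n, hn⟩
  let c : ℕ → ℝ := fun n => Nat.rec (q 0) (fun m r => min r (q (m + 1))) n
  let d : ℕ → ℝ := fun n => Nat.rec (q 0) (fun m r => max r (q (m + 1))) n
  have hc_succ : ∀ n, c (n + 1) = min (c n) (q (n + 1)) := fun n => rfl
  have hd_succ : ∀ n, d (n + 1) = max (d n) (q (n + 1)) := fun n => rfl
  have hc : Antitone c := antitone_nat_of_succ_le fun n => min_le_left _ _
  have hd : Monotone d := monotone_nat_of_le_succ fun n => le_max_left _ _
  have hcd : ∀ n, c n ≤ d n := fun n =>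
    (hc (Nat.zero_le n)).trans (hd (Nat.zero_le n))
  have hcq : ∀ n, c n ≤ q n := by
    rintro (_ | n)
    · exact le_refl _
    · exact min_le_right _ _
  have hqd : ∀ n, q n ≤ d n := by
    rintro (_ | n)
    · exact le_refl _
    · exact le_max_right _ _
  have hcK : ∀ n, c n ∈ K := by
    intro n
    induction n with
    | zero => exact hq 0
    | succ n ih => rw [hc_succ]; rcases min_choice (c n) (q (n + 1)) with h | h <;> rw [h]
                   exacts [ih, hq _]
  have hdK : ∀ n, d n ∈ K := by
    intro n
    induction n with
    | zero => exact hq 0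
    | succ n ih => rw [hd_succ]; rcases max_choice (d n) (q (n + 1)) with h | h <;> rw [h]
                   exacts [ih, hq _]
  have hcover : ∀ t ∈ K, ∃ n, t ∈ Set.Ioo (c n) (d n) := by
    intro t ht
    obtain ⟨ε, hε, hball⟩ := Metric.isOpen_iff.1 hKo t ht
    have hmem : ∀ s, |s - t| < ε → s ∈ K := fun s hs =>
      hball (by rwa [Metric.mem_ball, Real.dist_eq])
    obtain ⟨i, hi⟩ := hdense (Set.Iio t) isOpen_Iio
      ⟨t - ε / 2, by simpa using hε, hmem _ (by rw [abs_lt]; constructor <;> linarith)⟩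
    obtain ⟨j, hj⟩ := hdense (Set.Ioi t) isOpen_Ioi
      ⟨t + ε / 2, by simpa using hε, hmem _ (by rw [abs_lt]; constructor <;> linarith)⟩
    exact ⟨max i j, (hc (le_max_left i j)).trans_lt ((hcq i).trans_lt hi),
      lt_of_lt_of_le hj ((hqd j).trans (hd (le_max_right i j)))⟩
  have hIcc : ∀ x y, x ≤ y → x ∈ K → y ∈ K → ∃ k, IsLift H a (Set.Icc x y) k := by
    intro x y hxy hx hy
    rw [← Set.uIcc_of_le hxy]
    exact exists_isLift_uIcc hK hloc hx hy
  have hext : ∀ n (k : {k // IsLift H a (Set.Icc (c n) (d n)) k}),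
      ∃ k' : {k // IsLift H a (Set.Icc (c (n + 1)) (d (n + 1))) k},
        Set.EqOn k'.1 k.1 (Set.Icc (c n) (d n)) := by
    rintro n ⟨k, hk⟩
    obtain ⟨k₁, h₁⟩ := hIcc _ _ (hc n.le_succ) (hcK (n + 1)) (hcK n)
    obtain ⟨k₂, h₂⟩ := hIcc _ _ (hd n.le_succ) (hdK n) (hdK (n + 1))
    obtain ⟨k₃, h₃, e₃⟩ := h₁.glue_left (hc n.le_succ) (hcd n) hk
    obtain ⟨k₄, h₄, e₄⟩ := h₃.glue_right ((hc n.le_succ).trans (hcd n)) (hd n.le_succ) h₂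
    exact ⟨⟨k₄, h₄⟩, fun t ht => (e₄ ⟨(hc n.le_succ).trans ht.1, ht.2⟩).trans (e₃ ht)⟩
  choose next hnext using hext
  obtain ⟨k₀, h₀⟩ := hIcc _ _ (hcd 0) (hcK 0) (hdK 0)
  let s : ∀ n, {k // IsLift H a (Set.Icc (c n) (d n)) k} := fun n => Nat.rec ⟨k₀, h₀⟩ next n
  have hs : ∀ n, Set.EqOn (s (n + 1)).1 (s n).1 (Set.Icc (c n) (d n)) := fun n => hnext n (s n)
  have hs' : ∀ n m, n ≤ m → Set.EqOn (s m).1 (s n).1 (Set.Icc (c n) (d n)) := by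
    intro n m hnm
    induction m, hnm using Nat.le_induction with
    | base => exact fun _ _ => rfl
    | succ m hm ih =>
      exact fun t ht => (hs m ⟨(hc hm).trans ht.1, ht.2.trans (hd hm)⟩).trans (ih ht)
  -- the first subinterval that contains `t`; its lift is extended by all later ones
  let N : ℝ → ℕ := fun t => sInf {n | t ∈ Set.Icc (c n) (d n)}
  have hN : ∀ n, Set.EqOn (fun t => (s (N t)).1 t) (s n).1 (Set.Icc (c n) (d n)) := by
    intro n t ht
    have hmem : t ∈ Set.Icc (c (N t)) (d (N t)) :=
      Nat.sInf_mem (s := {n | t ∈ Set.Icc (c n) (d n)}) ⟨n, ht⟩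
    exact (hs' _ _ (Nat.sInf_le ht) hmem).symm
  refine ⟨fun t => (s (N t)).1 t, fun t => (s (N t)).2.1 t, fun t ht => ?_⟩
  obtain ⟨n, hn⟩ := hcover t ht
  have hmem : Set.Icc (c n) (d n) ∈ 𝓝 t := Icc_mem_nhds hn.1 hn.2
  refine ContinuousAt.continuousWithinAt (ContinuousAt.congr ((s n).2.2.continuousAt hmem) ?_)
  filter_upwards [hmem] with r hr
  exact congrArg (· • a r) (hN n hr).symm

variable [ContinuousConstSMul G X] [T2Space X] [Finite G]

/-- A point has a neighbourhood which only the elements of its stabilizer move to a set that meets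
it. -/
theorem exists_nhd_stabilizer (x : X) :
    ∃ V, IsOpen V ∧ x ∈ V ∧ ∀ h : G, ∀ v ∈ V, h • v ∈ V → h • x = x := by
  have key : ∀ h : G, ∃ V ∈ 𝓝 x, ∀ v ∈ V, h • v ∈ V → h • x = x := by
    intro h
    by_cases hx : h • x = x
    · exact ⟨Set.univ, Filter.univ_mem, fun _ _ _ => hx⟩
    · obtain ⟨A, B, hA, hB, hxA, hxB, hAB⟩ := t2_separation (Ne.symm hx)
      refine ⟨A ∩ (h • ·) ⁻¹' B, Filter.inter_mem (hA.mem_nhds hxA)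
        ((continuous_const_smul h).continuousAt.preimage_mem_nhds (hB.mem_nhds hxB)), ?_⟩
      exact fun v hv hv' => (Set.disjoint_left.1 hAB hv'.1 hv.2).elim
  choose V hV hV' using key
  refine ⟨interior (⋂ h, V h), isOpen_interior,
    mem_interior_iff_mem_nhds.2 (Filter.iInter_mem.2 hV), fun h v hv hv' => ?_⟩
  exact hV' h v (Set.mem_iInter.1 (interior_subset hv) h)
    (Set.mem_iInter.1 (interior_subset hv') h)

/-- Near a parameter `t` the path in the orbit space of `H` comes from a path in the orbit space of
the stabilizer of `a t` in `H`. -/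
theorem exists_local_isLift (ha : OrbitContinuous H a) (t : ℝ)
    (ih : ∀ b : ℝ → X, OrbitContinuous (H ⊓ MulAction.stabilizer G (a t)) b →
      ∃ k, IsLift (H ⊓ MulAction.stabilizer G (a t)) b Set.univ k) :
    ∃ ε > 0, ∃ k, IsLift H a (Set.Icc (t - ε) (t + ε)) k := by
  classical
  obtain ⟨V, hVo, hV, hVs⟩ := exists_nhd_stabilizer (G := G) (a t)
  obtain ⟨ε, hε, hball⟩ := Metric.eventually_nhds_iff_ball.1 (ha t V (hVo.mem_nhds hV))
  have hε2 : 0 < ε / 2 := half_pos hε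
  have hex : ∀ s, ∃ h ∈ H, s ∈ Set.Icc (t - ε / 2) (t + ε / 2) → h • a s ∈ V := by
    intro s
    by_cases hs : s ∈ Set.Icc (t - ε / 2) (t + ε / 2)
    · obtain ⟨h, hh, hs'⟩ := hball s (by
        rw [Metric.mem_ball, Real.dist_eq, abs_lt]
        constructor <;> linarith [hs.1, hs.2])
      exact ⟨h, hh, fun _ => hs'⟩
    · exact ⟨1, H.one_mem, fun h => (hs h).elim⟩
  choose k hk hkV using hex
  -- `φ` retracts `ℝ` onto the interval, so that the induction hypothesis, which is about functions
  -- on `ℝ`, applies to `s ↦ k (φ s) • a (φ s)`, whose values all lie in `V`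
  let φ : ℝ → ℝ := fun s => max (t - ε / 2) (min s (t + ε / 2))
  have hφ : Continuous φ := by fun_prop
  have hφmem : ∀ s, φ s ∈ Set.Icc (t - ε / 2) (t + ε / 2) := fun s =>
    ⟨le_max_left _ _, max_le (by linarith) (min_le_right _ _)⟩
  have hφid : ∀ s ∈ Set.Icc (t - ε / 2) (t + ε / 2), φ s = s := fun s hs => by
    simp only [φ]; rw [min_eq_left hs.2, max_eq_right hs.1]
  have hb : OrbitContinuous H (fun s => k (φ s) • a (φ s)) := (ha.smul hk).comp hφ
  have hb' : OrbitContinuous (H ⊓ MulAction.stabilizer G (a t))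
      (fun s => k (φ s) • a (φ s)) := by
    intro s W hW
    filter_upwards [hb s (W ∩ V) (Filter.inter_mem hW (hVo.mem_nhds (hkV _ (hφmem s))))]
      with r ⟨h, hh, hr⟩
    exact ⟨h, ⟨hh, hVs h _ (hkV _ (hφmem r)) hr.2⟩, hr.1⟩
  obtain ⟨k', hk'⟩ := ih _ hb'
  refine ⟨ε / 2, hε2, fun s => k' s * k (φ s), fun s => H.mul_mem (hk'.1 s).1 (hk _), ?_⟩
  refine (hk'.2.mono (Set.subset_univ _)).congr fun s hs => ?_
  simp [mul_smul, hφid s hs]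

/-- A path in the orbit space of a finite group acting on a Hausdorff space lifts to the space.

By induction on the group, it lifts locally away from the closed set `F` of parameters at which it
runs through a fixed point of `H`, hence over every component of the complement of `F`. At the
points of `F`, any choice of lifts is continuous. -/
theorem OrbitContinuous.exists_isLift (ha : OrbitContinuous H a) :
    ∃ k, IsLift H a Set.univ k := by
  classical
  induction H using WellFoundedLT.induction generalizing a with
  | ind H ih =>
  -- the parameters at which the path runs through a fixed point of `H`
  let F : Set ℝ := {t | ∀ h ∈ H, h • a t = a t}
  have hF : IsOpen Fᶜ := by
    refine isOpen_iff_mem_nhds.2 fun t ht => ?_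
    obtain ⟨V, hVo, hV, hVs⟩ := exists_nhd_stabilizer (G := G) (a t)
    filter_upwards [ha t V (hVo.mem_nhds hV)] with s ⟨k, hk, hs⟩ hsF
    rw [hsF k hk] at hs
    exact ht fun h hh => hVs h _ hs (by rwa [hsF h hh])
  -- away from `F`, stabilizers are proper subgroups of `H`, so the induction hypothesis gives lifts
  have hcomp : ∀ K : Set ℝ, ∃ k : ℝ → G, (∀ t, k t ∈ H) ∧
      (IsOpen K → IsPreconnected K → K ⊆ Fᶜ → IsLift H a K k) := by
    intro K
    by_cases h : IsOpen K ∧ IsPreconnected K ∧ K ⊆ Fᶜ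
    · obtain ⟨k, hk⟩ := exists_isLift_of_local (H := H) (a := a) h.2.1 h.1 fun t ht =>
        exists_local_isLift ha t fun b hb => ih _ (lt_of_le_of_ne inf_le_left fun he =>
          h.2.2 ht fun g hg => (inf_eq_left.1 he hg)) hb
      exact ⟨k, hk.1, fun _ _ _ => hk⟩
    · exact ⟨fun _ => 1, fun _ => H.one_mem, fun h1 h2 h3 => (h ⟨h1, h2, h3⟩).elim⟩
  choose k hkH hk using hcomp
  refine ⟨fun t => k (connectedComponentIn Fᶜ t) t, fun t => hkH _ t, ?_⟩
  refine continuousOn_univ.2 (continuous_iff_continuousAt.2 fun t => ?_)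
  by_cases ht : t ∈ F
  · intro V hV
    have hfix : ∀ h ∈ H, h • a t = a t := ht
    dsimp only at hV
    rw [hfix _ (hkH _ t)] at hV
    -- a neighbourhood of the fixed point all of whose translates lie in `V`
    have hV' : ⋂ h : H, (fun x => (h : G) • x) ⁻¹' V ∈ 𝓝 (a t) :=
      Filter.iInter_mem.2 fun h => (continuous_const_smul (h : G)).continuousAt.preimage_mem_nhds
        (by rwa [hfix h h.2])
    rw [Filter.mem_map]
    filter_upwards [ha t _ hV'] with s ⟨h, hh, hs⟩
    have := Set.mem_iInter.1 hs ⟨k (connectedComponentIn Fᶜ s) s * h⁻¹,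
      H.mul_mem (hkH _ s) (H.inv_mem hh)⟩
    simpa [mul_smul] using this
  · have hopen : IsOpen (connectedComponentIn Fᶜ t) := hF.connectedComponentIn
    have hnhd := hopen.mem_nhds (mem_connectedComponentIn ht)
    refine ((hk _ hopen isPreconnected_connectedComponentIn
      (connectedComponentIn_subset _ _)).2.continuousAt hnhd).congr ?_
    filter_upwards [hnhd] with s hs
    rw [connectedComponentIn_eq hs]

end OrbitPath

/-! ### Paths in the infinite symmetric product -/

namespace InfiniteSymmetricProduct

variable {X : Type u} {x₀ : X}

/-- The point of `SP(X)` represented by an `n`-tuple of points of `X`. -/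
def mk (x₀ : X) {n : ℕ} (a : Fin n → X) : InfiniteSymmetricProduct x₀ :=
  Quotient.mk (symmetricProductSetoid x₀) ⟨n, a⟩

theorem exists_mk_eq (p : InfiniteSymmetricProduct x₀) :
    ∃ (n : ℕ) (a : Fin n → X), mk x₀ a = p := by
  obtain ⟨⟨n, a⟩, rfl⟩ := Quotient.exists_rep p
  exact ⟨n, a, rfl⟩

theorem mk_eq_mk {n m : ℕ} {a : Fin n → X} {b : Fin m → X} :
    mk x₀ a = mk x₀ b ↔ reducedMultiset x₀ ⟨n, a⟩ = reducedMultiset x₀ ⟨m, b⟩ :=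
  Quotient.eq

open Classical in
theorem count_reducedMultiset {n : ℕ} (a : Fin n → X) {x : X} (hx : x ≠ x₀) :
    (reducedMultiset x₀ ⟨n, a⟩).count x = (Finset.univ.filter fun i => a i = x).card := by
  rw [reducedMultiset, Multiset.count_filter_of_pos (p := fun y => y ≠ x₀) hx, Multiset.count_map]
  simp only [eq_comm (a := x)]
  rfl

open Classical in
theorem count_reducedMultiset_self (a : Σ n : ℕ, (Fin n → X)) :
    (reducedMultiset x₀ a).count x₀ = 0 := by
  rw [reducedMultiset, Multiset.count_filter_of_neg (p := fun y => y ≠ x₀) (by simp)]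

theorem mem_reducedMultiset {n : ℕ} {a : Fin n → X} {x : X} :
    x ∈ reducedMultiset x₀ ⟨n, a⟩ ↔ (∃ i, a i = x) ∧ x ≠ x₀ := by
  classical
  simp [reducedMultiset]

theorem card_reducedMultiset_le {n : ℕ} (a : Fin n → X) :
    (reducedMultiset x₀ ⟨n, a⟩).card ≤ n := by
  classical
  refine (Multiset.card_le_card (Multiset.filter_le _ _)).trans ?_
  simp

theorem mk_comp_perm {n : ℕ} (a : Fin n → X) (τ : Equiv.Perm (Fin n)) :
    mk x₀ (a ∘ τ) = mk x₀ a := by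
  rw [mk_eq_mk, reducedMultiset, reducedMultiset]
  dsimp only
  rw [← Multiset.map_map, Multiset.map_univ_val_equiv]

/-- Two `n`-tuples represent the same point of `SP(X)` only if they agree up to a permutation. -/
theorem exists_perm_of_mk_eq {n : ℕ} {a b : Fin n → X} (h : mk x₀ a = mk x₀ b) :
    ∃ τ : Equiv.Perm (Fin n), a ∘ τ = b := by
  classical
  rw [mk_eq_mk] at h
  have hne : ∀ x, x ≠ x₀ →
      (Finset.univ.filter fun i => b i = x).card = (Finset.univ.filter fun i => a i = x).card := by
    intro x hx
    rw [← count_reducedMultiset b hx, ← count_reducedMultiset a hx, h]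
  have hcompl : (Finset.univ.filter fun i => ¬ b i = x₀).card =
      (Finset.univ.filter fun i => ¬ a i = x₀).card := by
    have := congrArg Multiset.card h
    simp only [reducedMultiset, Multiset.filter_map, Multiset.card_map] at this
    exact this.symm
  have hcard : ∀ x,
      (Finset.univ.filter fun i => b i = x).card = (Finset.univ.filter fun i => a i = x).card := by
    intro x
    by_cases hx : x = x₀
    · subst hx
      have h1 := Finset.card_filter_add_card_filter_not (s := (Finset.univ : Finset (Fin n)))
        (fun i => b i = x)
      have h2 := Finset.card_filter_add_card_filter_not (s := (Finset.univ : Finset (Fin n)))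
        (fun i => a i = x)
      omega
    · exact hne x hx
  -- the fibers of `a` and `b` have equal size; bijections between them make up the permutation
  have e : ∀ x, {i // b i = x} ≃ {i // a i = x} := fun x =>
    Fintype.equivOfCardEq (by rw [Fintype.card_subtype, Fintype.card_subtype, hcard x])
  refine ⟨(Equiv.sigmaFiberEquiv b).symm.trans ((Equiv.sigmaCongrRight e).trans
    (Equiv.sigmaFiberEquiv a)), funext fun i => ?_⟩
  exact (e (b i) ⟨i, rfl⟩).2

/-- The tuple with entries `b k` or `x₀`, as prescribed by `f`, represents the same point as `b` if
`f` takes every value `some k` at most once, and at least once if `b k ≠ x₀`. -/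
theorem mk_elim {n m : ℕ} (b : Fin m → X) (f : Fin n → Option (Fin m))
    (hinj : ∀ i j k, f i = some k → f j = some k → i = j)
    (hsupp : ∀ k, b k ≠ x₀ → ∃ i, f i = some k) :
    mk x₀ (fun i => (f i).elim x₀ b) = mk x₀ b := by
  classical
  rw [mk_eq_mk]
  ext x
  by_cases hx : x = x₀
  · subst hx
    rw [count_reducedMultiset_self, count_reducedMultiset_self]
  rw [count_reducedMultiset _ hx, count_reducedMultiset _ hx]
  symm
  have hs : ∀ k ∈ Finset.univ.filter fun k => b k = x, ∃ i, f i = some k := fun k hk =>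
    hsupp k (by rw [(Finset.mem_filter.1 hk).2]; exact hx)
  choose g hg using hs
  refine Finset.card_bij g (fun k hk => ?_) (fun k hk l hl hkl => ?_) (fun i hi => ?_)
  · simpa [hg k hk] using hk
  · have h1 := hg k hk
    rw [hkl, hg l hl] at h1
    exact (Option.some.inj h1).symm
  · obtain ⟨k, hk⟩ : ∃ k, f i = some k := by
      cases hfi : f i with
      | none => simp [hfi] at hi; exact (hx hi.symm).elim
      | some k => exact ⟨k, rfl⟩
    have hkm : k ∈ Finset.univ.filter fun k => b k = x := by simpa [hk] using hi
    exact ⟨k, hkm, hinj _ _ _ (hg k hkm) hk⟩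

theorem exists_option_of_card_le {n m : ℕ} (s : Finset (Fin m)) (hs : s.card ≤ n) :
    ∃ f : Fin n → Option (Fin m), (∀ i j k, f i = some k → f j = some k → i = j) ∧
      ∀ k ∈ s, ∃ i, f i = some k := by
  classical
  obtain ⟨e⟩ : Nonempty (s ↪ Fin n) :=
    Function.Embedding.nonempty_of_card_le (by simpa using hs)
  have he := e.injective.isPartialInv
  refine ⟨fun i => (Function.partialInv e i).map Subtype.val, fun i j k hi hj => ?_,
    fun k hk => ⟨e ⟨k, hk⟩, ?_⟩⟩
  · obtain ⟨u, hu, rfl⟩ := Option.map_eq_some_iff.1 hi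
    obtain ⟨v, hv, hvu⟩ := Option.map_eq_some_iff.1 hj
    rw [← (he u i).1 hu, ← (he v j).1 hv, Subtype.ext hvu]
  · rw [Option.map_eq_some_iff]
    exact ⟨⟨k, hk⟩, (he _ _).2 rfl, rfl⟩

/-- The number of points, other than the base point, of an element of `SP(X)`. -/
def degree (p : InfiniteSymmetricProduct x₀) : ℕ :=
  Quotient.lift (fun a => (reducedMultiset x₀ a).card) (fun _ _ h => congrArg Multiset.card h) p

theorem degree_mk {n : ℕ} (a : Fin n → X) :
    degree (mk x₀ a) = (reducedMultiset x₀ ⟨n, a⟩).card :=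
  rfl

theorem degree_mk_le {n : ℕ} (a : Fin n → X) : degree (mk x₀ a) ≤ n :=
  card_reducedMultiset_le a

theorem exists_option_of_degree_le {n m : ℕ} (b : Fin m → X) (h : degree (mk x₀ b) ≤ n) :
    ∃ f : Fin n → Option (Fin m), (∀ i j k, f i = some k → f j = some k → i = j) ∧
      ∀ k, b k ≠ x₀ → ∃ i, f i = some k := by
  classical
  obtain ⟨f, hf, hs⟩ := exists_option_of_card_le (n := n)
    (Finset.univ.filter fun k => b k ≠ x₀) (by
      rw [degree_mk, reducedMultiset, Multiset.filter_map, Multiset.card_map] at h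
      exact h)
  exact ⟨f, hf, fun k hk => hs k (by simpa using hk)⟩

theorem exists_mk_eq_of_degree_le {n : ℕ} {p : InfiniteSymmetricProduct x₀} (h : degree p ≤ n) :
    ∃ a : Fin n → X, mk x₀ a = p := by
  obtain ⟨m, b, rfl⟩ := exists_mk_eq p
  obtain ⟨f, hf, hs⟩ := exists_option_of_degree_le b h
  exact ⟨_, mk_elim b f hf hs⟩

theorem mk_cons_base {n : ℕ} (a : Fin n → X) :
    mk x₀ (Fin.cons x₀ a : Fin (n + 1) → X) = mk x₀ a := by
  have h := mk_elim (x₀ := x₀) a (Fin.cons none some : Fin (n + 1) → Option (Fin n))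
    (fun i j k => by cases i using Fin.cases <;> cases j using Fin.cases <;> simp; grind)
    (fun k _ => ⟨k.succ, by simp⟩)
  refine Eq.trans (congrArg (mk x₀) (funext fun i => ?_)) h
  cases i using Fin.cases <;> rfl

variable [TopologicalSpace X]

theorem continuous_mk (x₀ : X) (n : ℕ) : Continuous (mk x₀ : (Fin n → X) → _) :=
  continuous_quotient_mk'.comp (@continuous_sigmaMk ℕ (fun n => Fin n → X) _ n)

theorem isClosed_iff {C : Set (InfiniteSymmetricProduct x₀)} :
    IsClosed C ↔ ∀ n, IsClosed (mk x₀ ⁻¹' C : Set (Fin n → X)) := by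
  exact ((isQuotientMap_quotient_mk' (s := symmetricProductSetoid x₀)).isClosed_preimage).symm.trans
    isClosed_sigma_iff

theorem mk_const_base (x₀ : X) (n : ℕ) : mk x₀ (fun _ : Fin n => x₀) = incl x₀ x₀ := by
  refine mk_eq_mk.2 ((Multiset.eq_zero_of_forall_notMem fun x hx => ?_).trans
    (Multiset.eq_zero_of_forall_notMem fun x hx => ?_).symm) <;>
  · obtain ⟨⟨-, h⟩, hx⟩ := mem_reducedMultiset.1 hx
    exact hx h.symm

theorem mk_cons_const_base (x : X) (n : ℕ) :
    mk x₀ (Fin.cons x fun _ => x₀ : Fin (n + 1) → X) = incl x₀ x := by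
  have h := mk_elim (x₀ := x₀) (fun _ : Fin 1 => x)
    (Fin.cons (some 0) fun _ => none : Fin (n + 1) → Option (Fin 1))
    (fun i j k => by cases i using Fin.cases <;> cases j using Fin.cases <;> simp)
    (fun k _ => ⟨0, by simp [Subsingleton.elim k 0]⟩)
  refine Eq.trans (congrArg (mk x₀) (funext fun i => ?_)) h
  cases i using Fin.cases <;> rfl

/-- A loop in `SP(X)` that is represented by an `n`-tuple of loops in `X` is homotopic to the image
of their product: run through the loops of the tuple one after the other. -/
theorem exists_homotopic_map_incl_of_tuple (n : ℕ) (w : Fin n → Path x₀ x₀)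
    (ω : Path (incl x₀ x₀) (incl x₀ x₀)) (hω : ∀ t, ω t = mk x₀ fun i => w i t) :
    ∃ γ : Path x₀ x₀, ω.Homotopic (γ.map (incl x₀).continuous) := by
  induction n generalizing ω with
  | zero =>
    refine ⟨Path.refl x₀, ?_⟩
    have : ω = (Path.refl x₀).map (incl x₀).continuous := by
      ext t
      rw [hω t, ← funext (finZeroElim : ∀ i : Fin 0, x₀ = w i t), mk_const_base x₀ 0]
      rfl
    rw [this]
  | succ n ih =>
    have hcast : ∀ (m : ℕ), incl x₀ x₀ = mk x₀ (fun _ : Fin m => x₀) := fun m =>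
      (mk_const_base x₀ m).symm
    let tuple : ∀ {m : ℕ}, (Fin m → Path x₀ x₀) → Path (incl x₀ x₀) (incl x₀ x₀) := fun {m} u =>
      ((Path.pi u).map (continuous_mk x₀ m)).cast (hcast m) (hcast m)
    obtain ⟨γ, hγ⟩ := ih (fun i => w i.succ) (tuple fun i => w i.succ) fun _ => rfl
    refine ⟨(w 0).trans γ, ?_⟩
    -- the entry `0` runs during the first half of the time, the others during the second
    let w' : Fin (n + 1) → Path x₀ x₀ :=
      Fin.cons ((w 0).trans (Path.refl x₀)) fun i => (Path.refl x₀).trans (w i.succ)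
    have hw : ∀ i, (w i).Homotopic (w' i) := by
      intro i
      cases i using Fin.cases with
      | zero => exact ⟨(Path.Homotopy.transRefl _).symm⟩
      | succ i => exact ⟨(Path.Homotopy.reflTrans _).symm⟩
    have h₁ : ω.Homotopic (tuple w') := by
      have hpi : (Path.pi w).Homotopic (Path.pi w') :=
        ⟨Path.Homotopic.piHomotopy w w' fun i => Classical.choice (hw i)⟩
      have : ω = tuple w := by
        ext t
        exact hω t
      rw [this]
      exact (hpi.map ⟨_, continuous_mk x₀ (n + 1)⟩).pathCast _ _
    have h₂ : tuple w' = ((w 0).map (incl x₀).continuous).trans (tuple fun i => w i.succ) := by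
      ext t
      have : tuple w' t = mk x₀ (Fin.cons ((w 0).trans (Path.refl x₀) t)
          fun i => (Path.refl x₀).trans (w i.succ) t : Fin (n + 1) → X) := by
        refine congrArg (mk x₀) (funext fun i => ?_)
        cases i using Fin.cases <;> rfl
      rw [this]
      simp only [Path.trans_apply]
      split_ifs
      · exact mk_cons_const_base _ n
      · exact mk_cons_base _
    rw [Path.map_trans]
    exact (h₁.trans (by rw [h₂])).trans ((Path.Homotopic.refl _).hcomp hγ)

variable [T2Space X]

/-- A set of elements of degree at most `n` is closed in `SP(X)` if it is closed in
`SP^n(X) = X^n / S_n`. -/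
theorem isClosed_of_degree_le {n : ℕ} {C : Set (InfiniteSymmetricProduct x₀)}
    (hdeg : ∀ p ∈ C, degree p ≤ n) (hC : IsClosed (mk x₀ ⁻¹' C : Set (Fin n → X))) :
    IsClosed C := by
  refine isClosed_iff.2 fun m => ?_
  -- an `m`-tuple of degree at most `n` is obtained from an `n`-tuple by moving its entries to
  -- prescribed places and filling up with `x₀`; there are finitely many ways to do so
  have : (mk x₀ ⁻¹' C : Set (Fin m → X)) =
      ⋃ f : {f : Fin n → Option (Fin m) // ∀ i j k, f i = some k → f j = some k → i = j},
        {b | ∀ k, (∀ i, f.1 i ≠ some k) → b k = x₀} ∩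
          (fun b i => (f.1 i).elim x₀ b) ⁻¹' (mk x₀ ⁻¹' C) := by
    ext b
    simp only [Set.mem_preimage, Set.mem_iUnion, Set.mem_inter_iff, Set.mem_ofPred_eq]
    constructor
    · intro hb
      obtain ⟨f, hf, hs⟩ := exists_option_of_degree_le b (hdeg _ hb)
      refine ⟨⟨f, hf⟩, fun k hk => ?_, by rwa [mk_elim b f hf hs]⟩
      by_contra h
      obtain ⟨i, hi⟩ := hs k h
      exact hk i hi
    · rintro ⟨⟨f, hf⟩, hb, hbC⟩
      rwa [mk_elim b f hf fun k hk => by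
        by_contra h
        push Not at h
        exact hk (hb k h)] at hbC
  rw [this]
  refine isClosed_iUnion_of_finite fun f => IsClosed.inter ?_ (hC.preimage ?_)
  · simp only [Set.ofPred_forall]
    exact isClosed_iInter fun k => isClosed_iInter fun _ =>
      isClosed_eq (continuous_apply k) continuous_const
  · refine continuous_pi fun i => ?_
    cases f.1 i with
    | none => exact continuous_const
    | some k => exact continuous_apply k

instance : T1Space (InfiniteSymmetricProduct x₀) := by
  classical
  refine ⟨fun p => ?_⟩
  obtain ⟨m, b, rfl⟩ := exists_mk_eq p
  refine isClosed_of_degree_le (n := m) (fun q hq => by rw [hq]; exact degree_mk_le b) ?_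
  -- every entry of a representative of the point is `x₀` or an entry of `b`
  refine Set.Finite.isClosed ((Set.Finite.pi' (ι := Fin m) (t := fun _ => insert x₀ (Set.range b))
    fun _ => (Set.finite_range b).insert x₀).subset fun a ha i => ?_)
  by_cases h : a i = x₀
  · exact Or.inl h
  · right
    have : a i ∈ reducedMultiset x₀ ⟨m, a⟩ := mem_reducedMultiset.2 ⟨⟨i, rfl⟩, h⟩
    rw [mk_eq_mk.1 ha] at this
    exact (mem_reducedMultiset.1 this).1

/-- A compact subset of `SP(X)` is contained in a finite stage of the colimit. -/
theorem exists_degree_le_of_isCompact {K : Set (InfiniteSymmetricProduct x₀)} (hK : IsCompact K) :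
    ∃ n, ∀ p ∈ K, degree p ≤ n := by
  by_contra! h
  choose p hpK hp using h
  -- the tails of this sequence are closed, since each stage contains only finitely many terms
  let A : ℕ → Set (InfiniteSymmetricProduct x₀) := fun k => p '' Set.Ici k
  have hA : ∀ k, IsClosed (A k) := by
    refine fun k => isClosed_iff.2 fun m => ?_
    have : (mk x₀ ⁻¹' A k : Set (Fin m → X)) = mk x₀ ⁻¹' (p '' (Set.Ici k ∩ Set.Iio m)) := by
      ext b
      constructor
      · rintro ⟨n, hn, hb⟩
        exact ⟨n, ⟨hn, (hp n).trans_le (by rw [hb]; exact degree_mk_le b)⟩, hb⟩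
      · rintro ⟨n, hn, hb⟩
        exact ⟨n, hn.1, hb⟩
    rw [this]
    exact ((((Set.finite_Iio m).subset Set.inter_subset_right).image p).isClosed).preimage
      (continuous_mk x₀ m)
  obtain ⟨q, hq⟩ := IsCompact.nonempty_iInter_of_sequence_nonempty_isCompact_isClosed A
    (fun k => Set.image_mono (Set.Ici_subset_Ici.2 k.le_succ))
    (fun k => ⟨p k, k, Set.mem_Ici.2 le_rfl, rfl⟩)
    (hK.of_isClosed_subset (hA 0) (by rintro _ ⟨n, -, rfl⟩; exact hpK n)) hA
  obtain ⟨n, hn, hnq⟩ := Set.mem_iInter.1 hq (degree q)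
  have := hp n
  rw [hnq] at this
  exact absurd (Set.mem_Ici.1 hn) (not_le.2 this)

/-- Every path in `SP(X)` is represented by a path in some power `X^n`. -/
theorem exists_lift_path (ω : C(I, InfiniteSymmetricProduct x₀)) :
    ∃ (n : ℕ) (w : C(I, Fin n → X)), ∀ t, mk x₀ (w t) = ω t := by
  obtain ⟨n, hn⟩ := exists_degree_le_of_isCompact (isCompact_range ω.continuous)
  choose a ha using fun t => exists_mk_eq_of_degree_le (hn (ω t) ⟨t, rfl⟩)
  have : ContinuousConstSMul (Equiv.Perm (Fin n))ᵈᵐᵃ (Fin n → X) :=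
    ⟨fun c => continuous_pi fun i => continuous_apply _⟩
  have : Finite (Equiv.Perm (Fin n))ᵈᵐᵃ := Finite.of_equiv _ DomMulAct.mk
  let r : ℝ → I := Set.projIcc 0 1 zero_le_one
  have hcont : OrbitPath.OrbitContinuous (⊤ : Subgroup (Equiv.Perm (Fin n))ᵈᵐᵃ) (a ∘ r) := by
    intro t V hV
    obtain ⟨V₀, hV₀, hVo, hmem⟩ := mem_nhds_iff.1 hV
    -- the elements of degree at most `n` without a representative in `V₀`; they form a closed set,
    -- which `ω` avoids near `t`
    have hC : IsClosed {p : InfiniteSymmetricProduct x₀ | degree p ≤ n ∧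
        ∀ b : Fin n → X, mk x₀ b = p → b ∉ V₀} := by
      refine isClosed_of_degree_le (n := n) (fun p hp => hp.1) ?_
      have : (mk x₀ ⁻¹' {p : InfiniteSymmetricProduct x₀ | degree p ≤ n ∧
          ∀ b : Fin n → X, mk x₀ b = p → b ∉ V₀} : Set (Fin n → X)) =
          ⋂ τ : Equiv.Perm (Fin n), (fun b => b ∘ τ) ⁻¹' V₀ᶜ := by
        ext b
        simp only [Set.mem_preimage, Set.mem_ofPred_eq, Set.mem_iInter, Set.mem_compl_iff]
        refine ⟨fun h τ => h.2 _ (mk_comp_perm b τ), fun h => ⟨degree_mk_le b, fun c hc => ?_⟩⟩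
        obtain ⟨τ, rfl⟩ := exists_perm_of_mk_eq hc.symm
        exact h τ
      rw [this]
      exact isClosed_iInter fun τ => hVo.isClosed_compl.preimage
        (continuous_pi fun i => continuous_apply _)
    have hnhd := (ω.continuous.comp continuous_projIcc : Continuous (ω ∘ r)).continuousAt (x := t)
      |>.preimage_mem_nhds (hC.isOpen_compl.mem_nhds fun h => h.2 _ (ha _) hmem)
    filter_upwards [hnhd] with s hs
    have hs' : ¬ (degree (ω (r s)) ≤ n ∧
        ∀ b : Fin n → X, mk x₀ b = ω (r s) → b ∉ V₀) := hs
    push Not at hs'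
    obtain ⟨b, hb, hbV⟩ := hs' (hn _ ⟨_, rfl⟩)
    obtain ⟨τ, rfl⟩ := exists_perm_of_mk_eq ((ha (r s)).trans hb.symm)
    exact ⟨DomMulAct.mk τ, trivial, hV₀ hbV⟩
  obtain ⟨k, -, hk⟩ := hcont.exists_isLift
  refine ⟨n, ⟨fun t => k t • a (r t), (continuousOn_univ.1 hk).comp continuous_subtype_val⟩,
    fun t => ?_⟩
  have hr : r t = t := Set.projIcc_val _ t
  rw [← ha t, ← mk_comp_perm (a t) (DomMulAct.mk.symm (k t)), ContinuousMap.coe_mk, hr]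
  rfl

/-- The inclusion `X → SP(X)` is surjective on fundamental groups. -/
theorem exists_homotopic_map_incl (ω : Path (incl x₀ x₀) (incl x₀ x₀)) :
    ∃ γ : Path x₀ x₀, ω.Homotopic (γ.map (incl x₀).continuous) := by
  obtain ⟨n, w, hw⟩ := exists_lift_path (ω : C(I, InfiniteSymmetricProduct x₀))
  -- the end points of `ω` are the base point, so each entry of the lift is a loop at `x₀`
  have hbase : ∀ t, ω t = incl x₀ x₀ → ∀ i, w t i = x₀ := by
    intro t ht i
    have h := (hw t).trans (ht.trans (mk_const_base x₀ n).symm)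
    obtain ⟨τ, hτ⟩ := exists_perm_of_mk_eq h.symm
    exact (congrFun hτ i).symm
  refine exists_homotopic_map_incl_of_tuple n (fun i =>
    { toFun := fun t => w t i
      continuous_toFun := (continuous_apply i).comp w.continuous
      source' := hbase 0 ω.source i
      target' := hbase 1 ω.target i }) ω fun t => (hw t).symm

end InfiniteSymmetricProduct

/-! ### Transport along paths and free homotopies -/

namespace PiOneAction

variable {N : Type*} {X : Type u} {Y : Type v} [TopologicalSpace X] [TopologicalSpace Y]

/-- A homotopy from `f` to `f'` during which the boundary of the cube moves along the path `γ`. -/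
def FreelyHomotopic {x y : X} (γ : Path x y) (f : GenLoop N X x) (f' : GenLoop N X y) : Prop :=
  ∃ F : ContinuousMap.Homotopy f.1 f'.1, ∀ s, ∀ z ∈ Cube.boundary N, F (s, z) = γ s

theorem FreelyHomotopic.of_homotopic {x : X} {f f' : GenLoop N X x}
    (h : GenLoop.Homotopic f f') : FreelyHomotopic (Path.refl x) f f' := by
  obtain ⟨F⟩ := h
  exact ⟨F.toHomotopy, fun s z hz => (F.eq_fst s hz).trans (GenLoop.boundary f z hz)⟩

theorem FreelyHomotopic.trans {x y z : X} {γ : Path x y} {δ : Path y z} {f : GenLoop N X x}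
    {f' : GenLoop N X y} {f'' : GenLoop N X z} (h : FreelyHomotopic γ f f')
    (h' : FreelyHomotopic δ f' f'') : FreelyHomotopic (γ.trans δ) f f'' := by
  obtain ⟨F, hF⟩ := h
  obtain ⟨F', hF'⟩ := h'
  refine ⟨F.trans F', fun s w hw => ?_⟩
  rw [ContinuousMap.Homotopy.trans_apply, Path.trans_apply]
  split_ifs
  · exact hF _ w hw
  · exact hF' _ w hw

variable [Fintype N]

theorem stretch_mem_boundary_of_le {y : N → I} (h : 1 / 2 ≤ radius y) :
    stretch y ∈ Cube.boundary N := by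
  obtain ⟨i, hi⟩ := exists_abs_eq_radius y (by linarith)
  refine ⟨i, ?_⟩
  rcases abs_cases (2 * (y i : ℝ) - 1) with ⟨h', -⟩ | ⟨h', -⟩
  · right; exact Set.projIcc_of_right_le _ (by linarith)
  · left; exact Set.projIcc_of_le_left _ (by linarith)

theorem genLoopTransport_refl_apply {x : X} (f : GenLoop N X x) (y : N → I) :
    genLoopTransport (Path.refl x) f y = f (stretch y) := by
  change glue f (Path.refl x) y = f (stretch y)
  rw [glue]
  split_ifs with h
  · rfl
  · exact (GenLoop.boundary f _ (stretch_mem_boundary_of_le (not_le.1 h).le)).symm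

/-- Transport along the constant path is trivial: the stretching of the cube is homotopic to the
identity through maps that preserve the faces. -/
theorem genLoopTransport_refl {x : X} (f : GenLoop N X x) :
    GenLoop.Homotopic (genLoopTransport (Path.refl x) f) f := by
  have hmem : ∀ (s : I) (y : N → I) (i : N),
      (1 - (s : ℝ)) * stretch y i + s * y i ∈ Set.Icc (0 : ℝ) 1 := fun s y i =>
    convex_Icc (0 : ℝ) 1 (stretch y i).2 (y i).2 (by linarith [s.2.2]) s.2.1 (by ring)
  have hc : Continuous fun q : I × (N → I) => f fun i => ⟨_, hmem q.1 q.2 i⟩ := by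
    have hs : ∀ i, Continuous fun q : I × (N → I) => (stretch q.2 i : ℝ) := fun i =>
      continuous_subtype_val.comp
        ((continuous_apply i).comp (continuous_stretch.comp continuous_snd))
    refine f.1.continuous.comp (continuous_pi fun i => Continuous.subtype_mk ?_ _)
    have := hs i
    fun_prop
  refine ⟨⟨⟨⟨_, hc⟩, fun y => ?_, fun y => ?_⟩, fun s y hy => ?_⟩⟩
  · refine Eq.trans (congrArg f (funext fun i => Subtype.ext ?_))
      (genLoopTransport_refl_apply f y).symm
    simp
  · exact congrArg f (funext fun i => Subtype.ext (by simp))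
  · refine (GenLoop.boundary f _ ?_).trans
      (GenLoop.boundary (genLoopTransport (Path.refl x) f) y hy).symm
    obtain ⟨i, hi⟩ := hy
    refine ⟨i, ?_⟩
    rcases hi with hi | hi
    · left
      have : stretch y i = 0 := Set.projIcc_of_le_left _ (by norm_num [hi])
      exact Subtype.ext (by simp [this, hi])
    · right
      have : stretch y i = 1 := Set.projIcc_of_right_le _ (by norm_num [hi])
      exact Subtype.ext (by simp [this, hi])

/-- A free homotopy along `γ` ends at the transport along `γ`: shrink the homotopy into the middle
of the cube while the collar runs through the rest of `γ`. -/
theorem FreelyHomotopic.genLoopTransport_homotopic {x y : X} {γ : Path x y} {f : GenLoop N X x}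
    {f' : GenLoop N X y} (h : FreelyHomotopic γ f f') :
    GenLoop.Homotopic (genLoopTransport γ f) f' := by
  obtain ⟨F, hF⟩ := h
  refine GenLoop.Homotopic.trans ?_ (genLoopTransport_refl f')
  have hc := continuous_glue (N := N) (F := fun q => F q) (G := fun q : I × I => γ (max q.1 q.2))
    (by fun_prop) (by fun_prop) (fun p z hz => by
      dsimp only
      rw [hF p z hz, max_eq_left unitInterval.nonneg'])
  refine ⟨⟨⟨⟨_, hc⟩, fun z => ?_, fun z => ?_⟩, fun s z hz => ?_⟩⟩
  · change glue (fun w => F (0, w)) (fun t => γ (max 0 t)) z = glue f γ z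
    refine congrFun (congrArg₂ glue (funext fun w => F.apply_zero w) (funext fun t => ?_)) z
    rw [max_eq_right unitInterval.nonneg']
  · change glue (fun w => F (1, w)) (fun t => γ (max 1 t)) z = glue f' (Path.refl y) z
    refine congrFun (congrArg₂ glue (funext fun w => F.apply_one w) (funext fun t => ?_)) z
    rw [max_eq_left unitInterval.le_one', γ.target]
    rfl
  · refine Eq.trans ?_ (GenLoop.boundary (genLoopTransport γ f) z hz).symm
    change glue (fun w => F (s, w)) (fun t => γ (max s t)) z = y
    rw [glue_of_mem_boundary _ _ hz, max_eq_right unitInterval.le_one', γ.target]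

/-- A loop is freely homotopic to its transport. The constant path accounts for the shrinking of
the loop into the middle of the cube. -/
theorem freelyHomotopic_genLoopTransport {x y : X} (γ : Path x y) (f : GenLoop N X x) :
    FreelyHomotopic ((Path.refl x).trans γ) f (genLoopTransport γ f) := by
  refine (FreelyHomotopic.of_homotopic (genLoopTransport_refl f).symm).trans ?_
  have hc := continuous_glue (N := N) (F := fun q : I × (N → I) => f q.2)
    (G := fun q : I × I => γ (min q.1 q.2)) (by fun_prop) (by fun_prop) (fun p z hz => by
      dsimp only
      rw [GenLoop.boundary f z hz, min_eq_right unitInterval.nonneg', γ.source])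
  refine ⟨⟨⟨_, hc⟩, fun z => ?_, fun z => ?_⟩, fun s z hz => ?_⟩
  · change glue f (fun t => γ (min 0 t)) z = glue f (Path.refl x) z
    refine congrFun (congrArg (glue f) (funext fun t => ?_)) z
    rw [min_eq_left unitInterval.nonneg', γ.source]
    rfl
  · change glue f (fun t => γ (min 1 t)) z = glue f γ z
    refine congrFun (congrArg (glue f) (funext fun t => ?_)) z
    rw [min_eq_right unitInterval.le_one']
  · change glue f (fun t => γ (min s t)) z = γ s
    rw [glue_of_mem_boundary _ _ hz, min_eq_left unitInterval.le_one']

/-- The constant loop is transported to the constant loop. -/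
theorem genLoopTransport_const {x y : X} (γ : Path x y) :
    GenLoop.Homotopic (genLoopTransport γ (GenLoop.const : GenLoop N X x)) GenLoop.const :=
  FreelyHomotopic.genLoopTransport_homotopic
    ⟨⟨⟨fun q => γ q.1, by fun_prop⟩, fun _ => γ.source, fun _ => γ.target⟩, fun _ _ _ => rfl⟩

theorem transport_refl {x : X} (a : HomotopyGroup N X x) :
    transport (Path.Homotopic.Quotient.refl x) a = a := by
  obtain ⟨f, rfl⟩ := Quotient.exists_rep a
  exact Quotient.sound (genLoopTransport_refl f)

theorem transport_trans {x y z : X} (γ : Path.Homotopic.Quotient x y)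
    (δ : Path.Homotopic.Quotient y z) (a : HomotopyGroup N X x) :
    transport (γ.trans δ) a = transport δ (transport γ a) := by
  obtain ⟨f, rfl⟩ := Quotient.exists_rep a
  obtain ⟨γ, rfl⟩ := Path.Homotopic.Quotient.mk_surjective γ
  obtain ⟨δ, rfl⟩ := Path.Homotopic.Quotient.mk_surjective δ
  have h := ((freelyHomotopic_genLoopTransport γ f).trans
    (freelyHomotopic_genLoopTransport δ (genLoopTransport γ f))).genLoopTransport_homotopic
  refine Eq.trans ?_ (Quotient.sound h)
  refine Quotient.sound (genLoopTransport_homotopic ?_ (GenLoop.Homotopic.refl f))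
  exact Path.Homotopic.symm (Path.Homotopic.hcomp ⟨Path.Homotopy.reflTrans γ⟩
    ⟨Path.Homotopy.reflTrans δ⟩)

end PiOneAction

/-! ### Induced maps on homotopy groups -/

namespace HomotopyGroup

open PiOneAction

variable {N : Type*} {X : Type u} {Y : Type v} [TopologicalSpace X] [TopologicalSpace Y]

/-- The image of a generalized loop under a continuous map. -/
def genLoopMap (φ : C(X, Y)) {x : X} (f : GenLoop N X x) : GenLoop N Y (φ x) :=
  ⟨φ.comp f.1, fun y hy => congrArg φ (GenLoop.boundary f y hy)⟩

/-- The map induced by a continuous map on homotopy groups. -/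
def map (φ : C(X, Y)) {x : X} (a : HomotopyGroup N X x) : HomotopyGroup N Y (φ x) :=
  Quotient.map (genLoopMap φ) (fun _ _ h => ContinuousMap.HomotopicRel.comp_continuousMap h φ) a

theorem map_transport [Fintype N] (φ : C(X, Y)) {x y : X} (γ : Path.Homotopic.Quotient x y)
    (a : HomotopyGroup N X x) : map φ (transport γ a) = transport (γ.map φ) (map φ a) := by
  obtain ⟨f, rfl⟩ := Quotient.exists_rep a
  obtain ⟨γ, rfl⟩ := Path.Homotopic.Quotient.mk_surjective γ
  refine congrArg (Quotient.mk _) (GenLoop.ext _ _ fun y => ?_)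
  change φ (glue f γ y) = glue (fun z => φ (f z)) (fun t => φ (γ t)) y
  rw [glue, glue, apply_ite φ]

variable [DecidableEq N] [Nonempty N]

/-- The homomorphism induced by a continuous map on homotopy groups. -/
def mapHom (φ : C(X, Y)) (x : X) : HomotopyGroup N X x →* HomotopyGroup N Y (φ x) :=
  MonoidHom.mk' (map φ) fun a b => by
    obtain ⟨f, rfl⟩ := Quotient.exists_rep a
    obtain ⟨g, rfl⟩ := Quotient.exists_rep b
    let i : N := Classical.arbitrary N
    have h₁ := mul_spec (i := i) (p := f) (q := g)
    have h₂ := mul_spec (i := i) (p := genLoopMap φ f) (q := genLoopMap φ g)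
    refine (congrArg (map φ) h₁).trans (Eq.trans ?_ h₂.symm)
    refine congrArg (Quotient.mk _) (GenLoop.ext _ _ fun y => ?_)
    change φ (GenLoop.transAt i g f y) = GenLoop.transAt i (genLoopMap φ g) (genLoopMap φ f) y
    rw [GenLoop.transAt, GenLoop.transAt, GenLoop.coe_copy, GenLoop.coe_copy, apply_ite φ]
    rfl

end HomotopyGroup

theorem map_actionLowerCentralSeries_le {X : Type u} {Y : Type v} [TopologicalSpace X]
    [TopologicalSpace Y] (φ : C(X, Y)) (x : X) (n k : ℕ) :
    (actionLowerCentralSeries X x n k).map (HomotopyGroup.mapHom φ x) ≤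
      actionLowerCentralSeries Y (φ x) n k := by
  induction k with
  | zero => exact le_top
  | succ k ih =>
    rw [actionLowerCentralSeries, actionLowerCentralSeries, MonoidHom.map_closure,
      Subgroup.closure_le]
    rintro _ ⟨_, ⟨g, a, ha, rfl⟩, rfl⟩
    refine Subgroup.subset_closure ⟨FundamentalGroup.map φ x g, HomotopyGroup.mapHom φ x a,
      ih ⟨a, ha, rfl⟩, ?_⟩
    rw [map_mul, map_inv]
    congr 1
    exact HomotopyGroup.map_transport φ _ a

/-- If the kernels of the maps induced by `φ` on the higher homotopy groups are fixed by the
fundamental group, nilpotency of the action passes from the target of `φ` to its source. -/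
theorem actionLowerCentralSeries_eq_bot_of_map {X : Type u} {Y : Type v} [TopologicalSpace X]
    [TopologicalSpace Y] (φ : C(X, Y)) (x : X) (n : ℕ)
    (hfix : ∀ (g : FundamentalGroup X x) (a : π_ (n + 2) X x),
      HomotopyGroup.mapHom φ x a = 1 → piOneAct (n + 2) g a = a)
    (h : ∃ c, actionLowerCentralSeries Y (φ x) n c = ⊥) :
    ∃ c, actionLowerCentralSeries X x n c = ⊥ := by
  obtain ⟨c, hc⟩ := h
  refine ⟨c + 1, ?_⟩
  rw [actionLowerCentralSeries, Subgroup.closure_eq_bot_iff]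
  rintro _ ⟨g, a, ha, rfl⟩
  have := map_actionLowerCentralSeries_le φ x n c ⟨a, ha, rfl⟩
  rw [hc, Subgroup.mem_bot] at this
  rw [hfix g a this, mul_inv_cancel]
  rfl

/-! ### The homotopy fiber -/

namespace HomotopyFiber

variable {P : Type*} {X : Type u} {Y : Type v} [TopologicalSpace P] [TopologicalSpace X]
  [TopologicalSpace Y]

/-- The concatenation of `β` and `ω`, parametrized by `[0, 2]` and extended to constants outside
of it. -/
def run (β ω : C(I, Y)) (τ : ℝ) : Y :=
  open Classical in
  if τ ≤ 1 then β (Set.projIcc 0 1 zero_le_one τ) else ω (Set.projIcc 0 1 zero_le_one (τ - 1))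

theorem run_of_le {β ω : C(I, Y)} {τ : ℝ} (h : τ ≤ 1) :
    run β ω τ = β (Set.projIcc 0 1 zero_le_one τ) :=
  if_pos h

theorem run_of_ge {β ω : C(I, Y)} (hβω : β 1 = ω 0) {τ : ℝ} (h : 1 ≤ τ) :
    run β ω τ = ω (Set.projIcc 0 1 zero_le_one (τ - 1)) := by
  rcases h.eq_or_lt with rfl | h
  · rw [run_of_le le_rfl, Set.projIcc_right, sub_self, Set.projIcc_left]
    exact hβω
  · exact if_neg (not_le.2 h)

theorem run_of_nonpos {β ω : C(I, Y)} {τ : ℝ} (h : τ ≤ 0) : run β ω τ = β 0 := by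
  rw [run_of_le (h.trans zero_le_one), Set.projIcc_of_le_left _ h]
  rfl

theorem run_two {β ω : C(I, Y)} (hβω : β 1 = ω 0) : run β ω 2 = ω 1 := by
  rw [run_of_ge hβω one_le_two, Set.projIcc_of_right_le _ (by norm_num)]
  rfl

theorem run_coe {β ω : C(I, Y)} (t : I) : run β ω t = β t := by
  rw [run_of_le t.2.2, Set.projIcc_val]

theorem run_one_add {β ω : C(I, Y)} (hβω : β 1 = ω 0) (t : I) : run β ω (1 + t) = ω t := by
  rw [run_of_ge hβω (le_add_of_nonneg_right t.2.1), add_sub_cancel_left, Set.projIcc_val]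

theorem run_const (y : Y) (τ : ℝ) :
    run (ContinuousMap.const I y) (ContinuousMap.const I y) τ = y :=
  ite_self _

theorem continuous_run {β ω : P → C(I, Y)} {τ : P → ℝ} (hβ : Continuous β) (hω : Continuous ω)
    (hτ : Continuous τ) (h : ∀ p, β p 1 = ω p 0) :
    Continuous fun p => run (β p) (ω p) (τ p) := by
  refine Continuous.if_le ?_ ?_ hτ continuous_const ?_
  · exact hβ.eval (continuous_projIcc.comp hτ)
  · exact hω.eval (continuous_projIcc.comp (hτ.sub continuous_const))
  · intro p hp
    rw [hp, Set.projIcc_right, sub_self, Set.projIcc_left]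
    exact h p

/-- The path `t ↦ run β ω (τ t)`. -/
def runPath (β ω : C(I, Y)) (h : β 1 = ω 0) (τ : C(I, ℝ)) : C(I, Y) :=
  ⟨fun t => run β ω (τ t), continuous_run continuous_const continuous_const τ.continuous fun _ => h⟩

theorem continuous_runPath {β ω : P → C(I, Y)} {τ : P → C(I, ℝ)} (hβ : Continuous β)
    (hω : Continuous ω) (hτ : Continuous τ) (h : ∀ p, β p 1 = ω p 0) :
    Continuous fun p => runPath (β p) (ω p) (h p) (τ p) := by
  refine ContinuousMap.continuous_of_continuous_uncurry _ ?_
  exact continuous_run (P := P × I) (hβ.comp continuous_fst) (hω.comp continuous_fst)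
    ((hτ.comp continuous_fst).eval continuous_snd) fun p => h p.1

/-- The speed `t ↦ (1 + r) t`, from the first half of `[0, 2]` (at `r = 0`) to all of it. -/
def fromFirst (r : I) : C(I, ℝ) := ⟨fun t => (1 + r) * t, by fun_prop⟩

/-- The speed `t ↦ (1 - r) + (1 + r) t`, from the second half of `[0, 2]` (at `r = 0`) to all of
it. -/
def fromSecond (r : I) : C(I, ℝ) := ⟨fun t => (1 - r) + (1 + r) * t, by fun_prop⟩

theorem continuous_fromFirst : Continuous fromFirst :=
  ContinuousMap.continuous_of_continuous_uncurry _ (by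
    change Continuous fun p : I × I => (1 + (p.1 : ℝ)) * p.2
    fun_prop)

theorem continuous_fromSecond : Continuous fromSecond :=
  ContinuousMap.continuous_of_continuous_uncurry _ (by
    change Continuous fun p : I × I => (1 - (p.1 : ℝ)) + (1 + p.1) * p.2
    fun_prop)

/-- The space of loops in `Y` at `y`. -/
abbrev Loops (y : Y) : Type v := {β : C(I, Y) // β 0 = y ∧ β 1 = y}

/-- The constant loop. -/
def Loops.const (y : Y) : Loops y := ⟨ContinuousMap.const I y, rfl, rfl⟩

variable (f : C(X, Y)) (x₀ : X)

/-- The projection of the homotopy fiber of `f` to the domain of `f`. -/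
def proj (y : Y) : C(HomotopyFiber f y, X) := ⟨fun z => z.1.1, by fun_prop⟩

/-- The base point of the homotopy fiber of `f` over `f x₀`. -/
def base : HomotopyFiber f (f x₀) := ⟨(x₀, ContinuousMap.const I (f x₀)), rfl, rfl⟩

/-- The inclusion of the loop space of the target into the homotopy fiber. -/
def ofLoop : C(Loops (f x₀), HomotopyFiber f (f x₀)) :=
  ⟨fun β => ⟨(x₀, β.1), β.2.1, β.2.2⟩, by fun_prop⟩

/-- The action of the loop space of the target on the homotopy fiber, up to homotopy: a loop is
prepended to the path. -/
def act (y : Y) : C(Loops y × HomotopyFiber f y, HomotopyFiber f y) where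
  toFun q := ⟨(q.2.1.1, runPath q.1.1 q.2.1.2 (q.1.2.2.trans q.2.2.1.symm) (fromFirst 1)), by
    constructor
    · change run _ _ ((1 + ((1 : I) : ℝ)) * ((0 : I) : ℝ)) = y
      rw [run_of_nonpos (by simp), q.1.2.1]
    · change run _ _ ((1 + ((1 : I) : ℝ)) * ((1 : I) : ℝ)) = f q.2.1.1
      rw [← q.2.2.2, ← run_two (q.1.2.2.trans q.2.2.1.symm)]
      norm_num⟩
  continuous_toFun := by
    refine Continuous.subtype_mk (Continuous.prodMk (by fun_prop) ?_) _
    exact continuous_runPath (by fun_prop) (by fun_prop) continuous_const _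

theorem act_const_base : act f (f x₀) (Loops.const (f x₀), base f x₀) = base f x₀ :=
  Subtype.ext (Prod.ext rfl (ContinuousMap.ext fun _ => run_const _ _))

variable {f x₀} {K : Type*} [TopologicalSpace K] {A : Set K}

/-- A map to the homotopy fiber whose projection is null-homotopic comes from the loop space of the
target: append the image of the null-homotopy to the paths. -/
theorem exists_homotopicRel_ofLoop (a : C(K, HomotopyFiber f (f x₀)))
    (ha : ∀ k ∈ A, a k = base f x₀)
    (h : ((proj f (f x₀)).comp a).HomotopicRel (ContinuousMap.const K x₀) A) :
    ∃ b : C(K, Loops (f x₀)), (∀ k ∈ A, b k = Loops.const (f x₀)) ∧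
      a.HomotopicRel ((ofLoop f x₀).comp b) A := by
  obtain ⟨h⟩ := h
  -- the image of the track of `k` under the null-homotopy
  let w : K → C(I, Y) := fun k => ⟨fun s => f (h (s, k)), by fun_prop⟩
  have hw : Continuous w := ContinuousMap.continuous_of_continuous_uncurry _ (by
    change Continuous fun p : K × I => f (h (p.2, p.1))
    fun_prop)
  have hmatch : ∀ k, (a k).1.2 1 = w k 0 := fun k =>
    (a k).2.2.trans (congrArg f (h.apply_zero k).symm)
  have hw1 : ∀ k, w k 1 = f x₀ := fun k => congrArg f (h.apply_one k)
  have hstart : ∀ r k, runPath _ _ (hmatch k) (fromFirst r) 0 = f x₀ := fun r k => by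
    change run _ _ ((1 + (r : ℝ)) * ((0 : I) : ℝ)) = _
    rw [run_of_nonpos (by simp), (a k).2.1]
  have hend : ∀ r k, runPath _ _ (hmatch k) (fromFirst r) 1 = f (h (r, k)) := fun r k => by
    change run _ _ ((1 + (r : ℝ)) * ((1 : I) : ℝ)) = _
    have : (1 + (r : ℝ)) * ((1 : I) : ℝ) = 1 + r := by simp
    rw [this, run_one_add (hmatch k)]
    rfl
  have hcont : Continuous fun q : I × K => runPath _ _ (hmatch q.2) (fromFirst q.1) :=
    continuous_runPath (by fun_prop) (by fun_prop) (continuous_fromFirst.comp continuous_fst) _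
  have hA : ∀ r, ∀ k ∈ A, runPath _ _ (hmatch k) (fromFirst r) = ContinuousMap.const I (f x₀) := by
    intro r k hk
    have h₁ : (a k).1.2 = ContinuousMap.const I (f x₀) := by rw [ha k hk]; rfl
    have h₂ : w k = ContinuousMap.const I (f x₀) := ContinuousMap.ext fun s =>
      congrArg f ((h.eq_snd s hk))
    ext t
    change run (a k).1.2 (w k) _ = f x₀
    rw [h₁, h₂, run_const]
  refine ⟨⟨fun k => ⟨runPath _ _ (hmatch k) (fromFirst 1), hstart 1 k,
    (hend 1 k).trans (hw1 k)⟩, Continuous.subtype_mk (hcont.comp (by fun_prop : Continuous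
      fun k : K => ((1 : I), k))) _⟩, fun k hk => Subtype.ext (hA 1 k hk), ⟨⟨⟨⟨fun q =>
    ⟨(h q, runPath _ _ (hmatch q.2) (fromFirst q.1)), hstart _ _, hend _ _⟩,
    Continuous.subtype_mk (Continuous.prodMk (by fun_prop) hcont) _⟩, fun k => ?_, fun k => ?_⟩,
    fun r k hk => ?_⟩⟩⟩
  · refine Subtype.ext (Prod.ext (h.apply_zero k) (ContinuousMap.ext fun t => ?_))
    change run _ _ ((1 + ((0 : I) : ℝ)) * t) = _
    have : (1 + ((0 : I) : ℝ)) * t = t := by simp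
    rw [this, run_coe]
  · exact Subtype.ext (Prod.ext (h.apply_one k) rfl)
  · refine Eq.trans (Subtype.ext (Prod.ext ?_ (hA r k hk))) (ha k hk).symm
    exact h.eq_snd r hk

/-- The inclusion of the loop space is homotopic to the orbit map of the base point: acting on the
base point appends the constant path to a loop. -/
theorem ofLoop_homotopicRel_act_base (b : C(K, Loops (f x₀)))
    (hb : ∀ k ∈ A, b k = Loops.const (f x₀)) :
    ((ofLoop f x₀).comp b).HomotopicRel
      ((act f (f x₀)).comp (b.prodMk (ContinuousMap.const K (base f x₀)))) A := by
  have hmatch : ∀ k, (b k).1 1 = ContinuousMap.const I (f x₀) 0 := fun k => (b k).2.2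
  have hcont : Continuous fun q : I × K => runPath _ _ (hmatch q.2) (fromFirst q.1) :=
    continuous_runPath (by fun_prop) (by fun_prop) (continuous_fromFirst.comp continuous_fst) _
  refine ⟨⟨⟨⟨fun q => ⟨(x₀, runPath _ _ (hmatch q.2) (fromFirst q.1)), ?_, ?_⟩,
    Continuous.subtype_mk (Continuous.prodMk (by fun_prop) hcont) _⟩, fun k => ?_, fun k => rfl⟩,
    fun r k hk => ?_⟩⟩
  · change run _ _ ((1 + (q.1 : ℝ)) * ((0 : I) : ℝ)) = _
    rw [run_of_nonpos (by simp), (b q.2).2.1]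
  · change run _ _ ((1 + (q.1 : ℝ)) * ((1 : I) : ℝ)) = _
    have : (1 + (q.1 : ℝ)) * ((1 : I) : ℝ) = 1 + q.1 := by simp
    rw [this, run_one_add (hmatch q.2)]
    rfl
  · refine Subtype.ext (Prod.ext rfl (ContinuousMap.ext fun t => ?_))
    change run _ _ ((1 + ((0 : I) : ℝ)) * t) = _
    have : (1 + ((0 : I) : ℝ)) * t = t := by simp
    rw [this, run_coe]
    rfl
  · refine Subtype.ext (Prod.ext rfl (ContinuousMap.ext fun t => ?_))
    change run (b k).1 _ _ = (b k).1 t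
    rw [hb k hk]
    exact run_const _ _

/-- The constant loop acts by a map that is homotopic to the identity relative to the base point. -/
theorem homotopicRel_act_const (g : C(K, HomotopyFiber f (f x₀)))
    (hg : ∀ k ∈ A, g k = base f x₀) :
    g.HomotopicRel
      ((act f (f x₀)).comp ((ContinuousMap.const K (Loops.const (f x₀))).prodMk g)) A := by
  have hmatch : ∀ k, ContinuousMap.const I (f x₀) 1 = (g k).1.2 0 := fun k => (g k).2.1.symm
  have hcont : Continuous fun q : I × K => runPath _ _ (hmatch q.2) (fromSecond q.1) :=
    continuous_runPath (by fun_prop) (by fun_prop) (continuous_fromSecond.comp continuous_fst) _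
  refine ⟨⟨⟨⟨fun q => ⟨((g q.2).1.1, runPath _ _ (hmatch q.2) (fromSecond q.1)), ?_, ?_⟩,
    Continuous.subtype_mk (Continuous.prodMk (by fun_prop) hcont) _⟩, fun k => ?_, fun k => ?_⟩,
    fun r k hk => ?_⟩⟩
  · change run _ _ ((1 - (q.1 : ℝ)) + (1 + q.1) * ((0 : I) : ℝ)) = _
    rw [run_of_le (by simpa using q.1.2.1)]
    rfl
  · change run _ _ ((1 - (q.1 : ℝ)) + (1 + q.1) * ((1 : I) : ℝ)) = _
    have : (1 - (q.1 : ℝ)) + (1 + q.1) * ((1 : I) : ℝ) = 2 := by simp; ring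
    rw [this, run_two (hmatch q.2), (g q.2).2.2]
  · refine Subtype.ext (Prod.ext rfl (ContinuousMap.ext fun t => ?_))
    change run _ _ ((1 - ((0 : I) : ℝ)) + (1 + ((0 : I) : ℝ)) * t) = _
    have : (1 - ((0 : I) : ℝ)) + (1 + ((0 : I) : ℝ)) * t = 1 + t := by simp
    rw [this, run_one_add (hmatch k)]
  · refine Subtype.ext (Prod.ext rfl (ContinuousMap.ext fun t => ?_))
    change run _ _ ((1 - ((1 : I) : ℝ)) + (1 + ((1 : I) : ℝ)) * t) =
      run _ _ ((1 + ((1 : I) : ℝ)) * t)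
    simp
    rfl
  · refine Subtype.ext (Prod.ext rfl (ContinuousMap.ext fun t => ?_))
    change run _ (g k).1.2 _ = (g k).1.2 t
    rw [hg k hk]
    exact run_const _ _

theorem exists_homotopicRel_act_base (a : C(K, HomotopyFiber f (f x₀)))
    (ha : ∀ k ∈ A, a k = base f x₀)
    (h : ((proj f (f x₀)).comp a).HomotopicRel (ContinuousMap.const K x₀) A) :
    ∃ b : C(K, Loops (f x₀)), (∀ k ∈ A, b k = Loops.const (f x₀)) ∧ a.HomotopicRel
      ((act f (f x₀)).comp (b.prodMk (ContinuousMap.const K (base f x₀)))) A := by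
  obtain ⟨b, hb, hab⟩ := exists_homotopicRel_ofLoop a ha h
  exact ⟨b, hb, hab.trans (ofLoop_homotopicRel_act_base b hb)⟩

end HomotopyFiber

/-! ### Nilpotency of the homotopy fiber -/

namespace HomotopyFiber

variable {X : Type u} {Y : Type v} [TopologicalSpace X] [TopologicalSpace Y] {f : C(X, Y)} {x₀ : X}

/-- A generalized loop that comes from the loop space of `Y` is fixed by every loop `g`: the map
`(y, t) ↦ b y · g t` is a free homotopy from it to itself along `g`. -/
theorem genLoopTransport_homotopic_of_proj {N : Type*} [Fintype N]
    (g : Path (base f x₀) (base f x₀))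
    (a : GenLoop N (HomotopyFiber f (f x₀)) (base f x₀))
    (ha : GenLoop.Homotopic (HomotopyGroup.genLoopMap (proj f (f x₀)) a) GenLoop.const) :
    GenLoop.Homotopic (PiOneAction.genLoopTransport g a) a := by
  obtain ⟨b, hb, hab⟩ := exists_homotopicRel_act_base (A := Cube.boundary N) a.1 a.2 ha
  let a' : GenLoop N (HomotopyFiber f (f x₀)) (base f x₀) :=
    ⟨(act f (f x₀)).comp (b.prodMk (ContinuousMap.const _ (base f x₀))), fun y hy => by
      change act f (f x₀) (b y, base f x₀) = base f x₀
      rw [hb y hy, act_const_base]⟩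
  have haa' : GenLoop.Homotopic a a' := hab
  have hg := homotopicRel_act_const (A := {0, 1}) (g : C(I, HomotopyFiber f (f x₀)))
    (by rintro _ (rfl | rfl); exacts [g.source, g.target])
  let g' : Path (base f x₀) (base f x₀) :=
    { toFun := fun t => act f (f x₀) (Loops.const (f x₀), g t)
      continuous_toFun := by fun_prop
      source' := by rw [g.source, act_const_base]
      target' := by rw [g.target, act_const_base] }
  have hgg' : g.Homotopic g' := hg
  have hfree : PiOneAction.FreelyHomotopic g' a' a' := by
    refine ⟨⟨⟨fun q => act f (f x₀) (b q.2, g q.1), by fun_prop⟩, fun y => ?_, fun y => ?_⟩,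
      fun s y hy => ?_⟩
    · change act f (f x₀) (b y, g 0) = act f (f x₀) (b y, base f x₀)
      rw [g.source]
    · change act f (f x₀) (b y, g 1) = act f (f x₀) (b y, base f x₀)
      rw [g.target]
    · change act f (f x₀) (b y, g s) = act f (f x₀) (Loops.const (f x₀), g s)
      rw [hb y hy]
  exact (PiOneAction.genLoopTransport_homotopic hgg' haa').trans
    (hfree.genLoopTransport_homotopic.trans haa'.symm)

theorem transport_eq_of_map_proj_base {N : Type*} [Fintype N]
    (g : Path.Homotopic.Quotient (base f x₀) (base f x₀))
    (a : HomotopyGroup N (HomotopyFiber f (f x₀)) (base f x₀))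
    (ha : HomotopyGroup.map (proj f (f x₀)) a = Quotient.mk _ GenLoop.const) :
    PiOneAction.transport g a = a := by
  obtain ⟨a, rfl⟩ := Quotient.exists_rep a
  obtain ⟨g, rfl⟩ := Path.Homotopic.Quotient.mk_surjective g
  exact Quotient.sound (genLoopTransport_homotopic_of_proj g a (Quotient.exact ha))

/-- The fundamental group of a path connected homotopy fiber fixes the kernel of the map
`π_N(F) → π_N(X)`, at every base point. -/
theorem transport_eq_of_map_proj {N : Type*} [Fintype N]
    [PathConnectedSpace (HomotopyFiber f (f x₀))] {z : HomotopyFiber f (f x₀)}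
    (g : Path.Homotopic.Quotient z z) (a : HomotopyGroup N (HomotopyFiber f (f x₀)) z)
    (ha : HomotopyGroup.map (proj f (f x₀)) a = Quotient.mk _ GenLoop.const) :
    PiOneAction.transport g a = a := by
  -- transport everything to the base point along `ζ`
  let ζ : Path.Homotopic.Quotient z (base f x₀) :=
    Path.Homotopic.Quotient.mk (PathConnectedSpace.somePath _ _)
  have hinj : ∀ c : HomotopyGroup N (HomotopyFiber f (f x₀)) z,
      PiOneAction.transport ζ.symm (PiOneAction.transport ζ c) = c := fun c => by
    rw [← PiOneAction.transport_trans, Path.Homotopic.Quotient.trans_symm,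
      PiOneAction.transport_refl]
  have hζ : PiOneAction.transport (ζ.symm.trans (g.trans ζ)) (PiOneAction.transport ζ a) =
      PiOneAction.transport ζ a := by
    refine transport_eq_of_map_proj_base _ _ ?_
    rw [HomotopyGroup.map_transport, ha]
    obtain ⟨γ, hγ⟩ := Path.Homotopic.Quotient.mk_surjective (ζ.map (proj f (f x₀)))
    rw [← hγ]
    exact Quotient.sound (PiOneAction.genLoopTransport_const γ)
  rw [← PiOneAction.transport_trans, ← Path.Homotopic.Quotient.trans_assoc,
    Path.Homotopic.Quotient.trans_symm, Path.Homotopic.Quotient.refl_trans,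
    PiOneAction.transport_trans] at hζ
  rw [← hinj (PiOneAction.transport g a), hζ, hinj]

/-- Loops that come from the loop space of `Y` commute with all loops: the two products are the
sides of the square `(s, t) ↦ b s · g t`. -/
theorem trans_homotopic_trans_of_proj (g a : Path (base f x₀) (base f x₀))
    (ha : (a.map (proj f (f x₀)).continuous).Homotopic (Path.refl x₀)) :
    (a.trans g).Homotopic (g.trans a) := by
  have hends : ∀ p : Path (base f x₀) (base f x₀), ∀ k ∈ ({0, 1} : Set I), p k = base f x₀ := by
    rintro p _ (rfl | rfl)
    exacts [p.source, p.target]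
  obtain ⟨b, hb, hab⟩ := exists_homotopicRel_act_base (A := {0, 1})
    (a : C(I, HomotopyFiber f (f x₀))) (hends a) ha
  have hg := homotopicRel_act_const (A := {0, 1}) (g : C(I, HomotopyFiber f (f x₀))) (hends g)
  let β : Path (Loops.const (f x₀)) (Loops.const (f x₀)) :=
    ⟨b, hb 0 (by simp), hb 1 (by simp)⟩
  let c : Path (Loops.const (f x₀)) (Loops.const (f x₀)) := Path.refl _
  let e : Path (base f x₀) (base f x₀) := Path.refl _
  let q : Path (Loops.const (f x₀), base f x₀) (Loops.const (f x₀), base f x₀) →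
      Path (base f x₀) (base f x₀) := fun p =>
    (p.map (act f (f x₀)).continuous).cast (act_const_base f x₀).symm (act_const_base f x₀).symm
  have hq : ∀ p p', p.Homotopic p' → (q p).Homotopic (q p') := fun p p' h =>
    (h.map (act f (f x₀))).pathCast _ _
  have hqt : ∀ p p', q (p.trans p') = (q p).trans (q p') := fun p p' => by
    simp only [q, Path.map_trans, Path.cast_trans]
    rfl
  have h₁ : a.Homotopic (q (β.prod e)) := hab
  have h₂ : g.Homotopic (q (c.prod g)) := hg
  have h₃ : ((β.prod e).trans (c.prod g)).Homotopic (β.prod g) := by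
    rw [Path.trans_prod_eq_prod_trans]
    exact ⟨Path.Homotopic.prodHomotopy (Path.Homotopy.transRefl β) (Path.Homotopy.reflTrans g)⟩
  have h₄ : ((c.prod g).trans (β.prod e)).Homotopic (β.prod g) := by
    rw [Path.trans_prod_eq_prod_trans]
    exact ⟨Path.Homotopic.prodHomotopy (Path.Homotopy.reflTrans β) (Path.Homotopy.transRefl g)⟩
  have h₅ := hq _ _ (h₃.trans h₄.symm)
  rw [hqt, hqt] at h₅
  exact ((h₁.hcomp h₂).trans h₅).trans (h₂.hcomp h₁).symm

theorem isNilpotent_fundamentalGroup_base [Group.IsNilpotent (FundamentalGroup X x₀)] :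
    Group.IsNilpotent (FundamentalGroup (HomotopyFiber f (f x₀)) (base f x₀)) := by
  have : Group.IsNilpotent (FundamentalGroup X (proj f (f x₀) (base f x₀))) :=
    inferInstanceAs (Group.IsNilpotent (FundamentalGroup X x₀))
  refine Subgroup.isNilpotent_of_ker_le_center
    (FundamentalGroup.map (proj f (f x₀)) (base f x₀)) fun a ha => ?_
  refine Subgroup.mem_center_iff.2 fun g => ?_
  obtain ⟨a, rfl⟩ := Path.Homotopic.Quotient.mk_surjective a
  obtain ⟨g, rfl⟩ := Path.Homotopic.Quotient.mk_surjective g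
  have ha' : (a.map (proj f (f x₀)).continuous).Homotopic (Path.refl x₀) :=
    Path.Homotopic.Quotient.exact ha
  exact Path.Homotopic.Quotient.eq.2 (trans_homotopic_trans_of_proj g a ha')

/-- The homotopy fiber of a `π₁`-surjective map from a path connected space is path connected. -/
theorem pathConnectedSpace [PathConnectedSpace X]
    (hsurj : ∀ ω : Path (f x₀) (f x₀), ∃ γ : Path x₀ x₀, ω.Homotopic (γ.map f.continuous)) :
    PathConnectedSpace (HomotopyFiber f (f x₀)) := by
  have hjoin : ∀ z : HomotopyFiber f (f x₀), Joined z (base f x₀) := by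
    intro z
    let γ₀ : Path z.1.1 x₀ := PathConnectedSpace.somePath _ _
    have h : ((proj f (f x₀)).comp (ContinuousMap.const Unit z)).HomotopicRel
        (ContinuousMap.const Unit x₀) ∅ :=
      ⟨⟨⟨⟨fun q => γ₀ q.1, by fun_prop⟩, fun _ => γ₀.source, fun _ => γ₀.target⟩,
        fun _ _ h => h.elim⟩⟩
    obtain ⟨b, -, ⟨H⟩⟩ := exists_homotopicRel_ofLoop (A := ∅) (ContinuousMap.const Unit z)
      (fun _ h => h.elim) h
    have h₁ : Joined z (ofLoop f x₀ (b ())) := ⟨H.toHomotopy.evalAt ()⟩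
    let ω : Path (f x₀) (f x₀) := ⟨(b ()).1, (b ()).2.1, (b ()).2.2⟩
    obtain ⟨γ, ⟨G⟩⟩ := hsurj ω
    -- from `z` to `(x₀, ω)` for a loop `ω`, on to `(x₀, f ∘ γ)`, and then back along `γ`
    let ωγ : Loops (f x₀) := ⟨f.comp γ, congrArg f γ.source, congrArg f γ.target⟩
    have h₂ : Joined (b ()) ωγ := by
      refine ⟨⟨⟨fun r => ⟨⟨fun t => G (r, t), by fun_prop⟩, G.source r, G.target r⟩,
        Continuous.subtype_mk (ContinuousMap.continuous_of_continuous_uncurry _ ?_) _⟩, ?_, ?_⟩⟩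
      · change Continuous fun p : I × I => G p
        fun_prop
      · exact Subtype.ext (ContinuousMap.ext fun t => G.apply_zero t)
      · exact Subtype.ext (ContinuousMap.ext fun t => G.apply_one t)
    have h₃ : Joined (base f x₀) (ofLoop f x₀ ωγ) := by
      refine ⟨⟨⟨fun r => ⟨(γ r, ⟨fun t => f (γ (r * t)), by fun_prop⟩), ?_, ?_⟩,
        Continuous.subtype_mk (Continuous.prodMk (by fun_prop)
          (ContinuousMap.continuous_of_continuous_uncurry _ ?_)) _⟩, ?_, ?_⟩⟩
      · simp
      · simp
      · change Continuous fun p : I × I => f (γ (p.1 * p.2))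
        fun_prop
      · refine Subtype.ext (Prod.ext γ.source (ContinuousMap.ext fun t => ?_))
        change f (γ (0 * t)) = f x₀
        simp
      · refine Subtype.ext (Prod.ext γ.target (ContinuousMap.ext fun t => ?_))
        change f (γ (1 * t)) = f (γ t)
        simp
    exact h₁.trans ((h₂.map (ofLoop f x₀).continuous).trans h₃.symm)
  exact ⟨⟨base f x₀⟩, fun z z' => (hjoin z).trans (hjoin z').symm⟩

/-- The homotopy fiber of a map from a nilpotent space is nilpotent if it is path connected. -/
theorem isNilpotentSpace (hX : IsNilpotentSpace X)
    [hF : PathConnectedSpace (HomotopyFiber f (f x₀))] :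
    IsNilpotentSpace (HomotopyFiber f (f x₀)) where
  pathConnected := hF
  nilpotent_fundamentalGroup z := by
    have := hX.nilpotent_fundamentalGroup x₀
    have := isNilpotent_fundamentalGroup_base (f := f) (x₀ := x₀)
    exact Group.nilpotent_of_mulEquiv
      (FundamentalGroup.fundamentalGroupMulEquivOfPathConnected (base f x₀) z)
  nilpotent_action z n :=
    actionLowerCentralSeries_eq_bot_of_map (proj f (f x₀)) z n
      (fun g a ha => transport_eq_of_map_proj _ a ha) (hX.nilpotent_action _ n)

end HomotopyFiber

end

theorem mainTheorem9 {L : Type u} [TopologicalSpace L] [T2Space L]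
    [Topology.CWComplex (Set.univ : Set L)] (hL : IsNilpotentSpace L) (x₀ : L) :
    IsNilpotentSpace
      (HomotopyFiber (InfiniteSymmetricProduct.incl x₀) (InfiniteSymmetricProduct.incl x₀ x₀)) := by
  have := hL.pathConnected
  have := HomotopyFiber.pathConnectedSpace (InfiniteSymmetricProduct.exists_homotopic_map_incl
    (x₀ := x₀))
  exact HomotopyFiber.isNilpotentSpace hL
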